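/- Setting. Let $d$ be a prime and $|G\rangle$ the graph state of $n$ qudits of dimension $d$ belonging to a graph $G=(V,E)$, $|V|=n$, with edge multiplicities $m_e\in\mathbb{Z}_d$, that is, $|G\rangle=\big(\prod_{e\in E}\mathrm{CZ}_e^{m_e}\big)|+\rangle^{\otimes n}$ in $\mathcal{H}=(\mathbb{C}^d)^{\otimes n}$, where $|+\rangle=d^{-1/2}\sum_{j\in\mathbb{Z}_d}|j\rangle$ and $\mathrm{CZ}_{(i,j)}|x\rangle=e^{2\pi \mathrm{i}\,x_ix_j/d}|x\rangle$. For $0<\lambda<1$ put $\nu=1-\lambda$, $\Omega=|G\rangle\langle G|+\lambda(1-|G\rangle\langle G|)$ and $\overline{\Omega}=1-\Omega$. For integers $0\le k\le N-1$ and a density operator $\rho$ on $\mathcal{H}^{\otimes(N+1)}$ that is invariant under permutations of the $N+1$ systems, let $$p_k(\rho)=\sum_{i=0}^k\binom{N}{i}\operatorname{tr}\big([\Omega^{\otimes(N-i)}\otimes\overline{\Omega}^{\otimes i}\otimes 1]\rho\big),\qquad f_k(\rho)=\sum_{i=0}^k\binom{N}{i}\operatorname{tr}\big([\Omega^{\otimes(N-i)}\otimes\overline{\Omega}^{\otimes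 i}\otimes|G\rangle\langle G|]\rho\big)$$ be the probability that at most $k$ of $N$ tests fail and the corresponding unnormalized fidelity of the remaining system. Define $$\bar\epsilon_\lambda(k,N,\delta)=1-\min_\rho\{f_k(\rho)/p_k(\rho) : p_k(\rho)\ge\delta\},\qquad B_{N,k}(p)=\sum_{j=0}^k\binom{N}{j}p^j(1-p)^{N-j},$$ the minimum being over all permutation-invariant density operators $\rho$ on $\mathcal{H}^{\otimes(N+1)}$. Let $N_{\min}(\epsilon,\delta,\lambda,r)$ be the least $N$ for which there is an integer $0\le k\le N-1$ with $$\bar\epsilon_\lambda(k,N,\delta)\le\epsilon\ \text{ (soundness)}\qquad\text{and}\qquad B_{N,k}(\nu r\epsilon)\ge1-\delta\ \text{ (robustness)}.\tag{$*$}$$ Theorem. Suppose $0<\lambda,\epsilon<1$, $0<\delta\le1/2$ and $0\le r<1$. If $$k=\left\lfloor\left(\frac{\lambda\sqrt{2\nu}+r}{\lambda\sqrt{2\nu}+1}\right)\nu\epsilon N\right\rfloor,\qquad N\ge\left\lceil\left[\frac{\lambda\sqrt{2\nu}+1}{\lambda\nu(1-r)}\right]^2\frac{\ln\delta^{-1}+4\lambda\nu^2}{\epsilon}\right\rceil,$$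 then $k\le N-1$ and both conditions $(*)$ hold. Hence $$N_{\min}(\epsilon,\delta,\lambda,r)\le\left\lceil\left[\frac{\lambda\sqrt{2\nu}+1}{\lambda\nu(1-r)}\right]^2\frac{\ln\delta^{-1}+4\lambda\nu^2}{\epsilon}\right\rceil,$$ and for every $\lambda$ and $r$ there is a constant $C>0$, depending only on $\lambda$ and $r$ (in particular not on $d$, the number $n$ of qudits, or the graph), such that $N_{\min}(\epsilon,\delta,\lambda,r)\le C\,\epsilon^{-1}\ln\delta^{-1}$ for all $0<\epsilon<1$ and $0<\delta\le1/2$. -/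

import Mathlib

open scoped ComplexOrder

noncomputable section

namespace RobustMBQC

/-- A graph on the vertices `Fin n` whose edges carry multiplicities in `ZMod d`. -/
structure QuditGraph (d n : ℕ) where
  /-- The underlying simple graph. -/
  graph : SimpleGraph (Fin n)
  /-- The multiplicity of each edge. -/
  mult : graph.edgeSet → ZMod d

/-- The diagonal of the generalized controlled-`Z` operation on the edge `e` of `n` qudits, in the
computational basis: for `e = s(i, j)` we have `CZ |x⟩ = ω ^ (x i * x j) |x⟩`, `ω = exp (2πi / d)`
(`ZMod.stdAddChar a` is `ω ^ a`). -/
def czDiag {d n : ℕ} [NeZero d] (e : Sym2 (Fin n)) (x : Fin n → ZMod d) : ℂ :=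
  ZMod.stdAddChar (Sym2.mul (e.map x))

/-- The product state `|+⟩ ⊗ ⋯ ⊗ |+⟩` of `n` qudits, where `|+⟩ = ∑ j, |j⟩ / √d`. -/
def plusState (d n : ℕ) : (Fin n → ZMod d) → ℂ :=
  fun _ => ∏ _i : Fin n, (1 / (Real.sqrt d : ℂ))

open Classical in
/-- The `n`-qudit graph state `|G⟩ = (∏ e ∈ E, CZ_e ^ m_e) |+⟩^{⊗ n}` (the operators `CZ_e` are
diagonal, so that their product is the diagonal operator with the product of the diagonals). -/
def QuditGraph.state {d n : ℕ} [NeZero d] (G : QuditGraph d n) : (Fin n → ZMod d) → ℂ :=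
  Matrix.mulVec
    (Matrix.diagonal (∏ e : G.graph.edgeSet, czDiag (e : Sym2 (Fin n)) ^ (G.mult e).val))
    (plusState d n)

/-! In the following, `ι` indexes an orthonormal basis of the one-system Hilbert space, and
`Fin m → ι` the product basis of its `m`-th tensor power. -/

section Protocol

variable {ι : Type*} [Fintype ι] [DecidableEq ι]

/-- The operator `|ψ⟩⟨ψ|`. -/
def ketBra (ψ : ι → ℂ) : Matrix ι ι ℂ := Matrix.vecMulVec ψ (star ψ)

/-- The verification operator `Ω = |ψ⟩⟨ψ| + lam (1 - |ψ⟩⟨ψ|)`. -/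
def verifOp (ψ : ι → ℂ) (lam : ℝ) : Matrix ι ι ℂ :=
  ketBra ψ + (lam : ℂ) • (1 - ketBra ψ)

/-- The tensor product `A 0 ⊗ A 1 ⊗ ⋯ ⊗ A (m - 1)` of one-system operators. -/
def tensorOp {m : ℕ} (A : Fin m → Matrix ι ι ℂ) : Matrix (Fin m → ι) (Fin m → ι) ℂ :=
  Matrix.of fun x y => ∏ j, A j (x j) (y j)

/-- Density operators: positive semidefinite operators of trace one. -/
def IsDensity {κ : Type*} [Fintype κ] (ρ : Matrix κ κ ℂ) : Prop :=
  ρ.PosSemidef ∧ ρ.trace = 1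

/-- Invariance of an operator under all permutations of the `m` systems. -/
def IsPermInvariant {m : ℕ} (ρ : Matrix (Fin m → ι) (Fin m → ι) ℂ) : Prop :=
  ∀ (π : Equiv.Perm (Fin m)) (x y : Fin m → ι), ρ (x ∘ π) (y ∘ π) = ρ x y

/-- The operator `Ω^{⊗ (N - i)} ⊗ (1 - Ω)^{⊗ i} ⊗ L` on `N + 1` systems. -/
def testOp (Ω L : Matrix ι ι ℂ) (N i : ℕ) :
    Matrix (Fin (N + 1) → ι) (Fin (N + 1) → ι) ℂ :=
  tensorOp fun j : Fin (N + 1) =>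
    if (j : ℕ) < N - i then Ω else if (j : ℕ) < N then 1 - Ω else L

/-- The probability `p_k(ρ)` that the permutation-invariant state `ρ` on `N + 1` systems shows at
most `k` failures in `N` tests. -/
def acceptProb (ψ : ι → ℂ) (lam : ℝ) (k N : ℕ)
    (ρ : Matrix (Fin (N + 1) → ι) (Fin (N + 1) → ι) ℂ) : ℝ :=
  ∑ i ∈ Finset.range (k + 1),
    (N.choose i : ℝ) * ((testOp (verifOp ψ lam) 1 N i * ρ).trace).re

/-- The unnormalized fidelity `f_k(ρ)` of the remaining system with the target state. -/
def acceptFid (ψ : ι → ℂ) (lam : ℝ) (k N : ℕ)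
    (ρ : Matrix (Fin (N + 1) → ι) (Fin (N + 1) → ι) ℂ) : ℝ :=
  ∑ i ∈ Finset.range (k + 1),
    (N.choose i : ℝ) * ((testOp (verifOp ψ lam) (ketBra ψ) N i * ρ).trace).re

/-- The fidelity `F_k(ρ) = f_k(ρ) / p_k(ρ)` of the remaining system after acceptance with the
target state. -/
def condFid (ψ : ι → ℂ) (lam : ℝ) (k N : ℕ)
    (ρ : Matrix (Fin (N + 1) → ι) (Fin (N + 1) → ι) ℂ) : ℝ :=
  acceptFid ψ lam k N ρ / acceptProb ψ lam k N ρ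

/-- The guaranteed infidelity
`1 - min {F_k(ρ) | p_k(ρ) ≥ δ}`, over the permutation-invariant states `ρ` on `N + 1` systems.
For a unit vector `ψ`, `0 < δ ≤ 1` and `k < N` the set is non-empty (it contains the value at the
`N + 1` copies of `ψ`, which are accepted with certainty) and compact, so that its infimum is a
minimum. -/
def guaranteedInfidelity (ψ : ι → ℂ) (lam : ℝ) (k N : ℕ) (δ : ℝ) : ℝ :=
  1 - sInf {F : ℝ | ∃ ρ : Matrix (Fin (N + 1) → ι) (Fin (N + 1) → ι) ℂ,
    IsDensity ρ ∧ IsPermInvariant ρ ∧ δ ≤ acceptProb ψ lam k N ρ ∧ F = condFid ψ lam k N ρ}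

/-- The binomial cumulative distribution function `B_{N,k}(p)`. -/
def binomCDF (N k : ℕ) (p : ℝ) : ℝ :=
  ∑ j ∈ Finset.range (k + 1), (N.choose j : ℝ) * p ^ j * (1 - p) ^ (N - j)

/-- The conditions of soundness and robustness for `N` tests with `k` allowed failures, target
state `ψ`, infidelity `ε`, significance level `δ` and robustness `r`; here `ν = 1 - lam`. -/
def SoundAndRobust (ψ : ι → ℂ) (lam r ε δ : ℝ) (k N : ℕ) : Prop :=
  guaranteedInfidelity ψ lam k N δ ≤ ε ∧ 1 - δ ≤ binomCDF N k ((1 - lam) * r * ε)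

/-- The minimum number `N_min` of tests required for robust verification. -/
def minTests (ψ : ι → ℂ) (ε δ lam r : ℝ) : ℕ :=
  sInf {N : ℕ | ∃ k : ℕ, k + 1 ≤ N ∧ SoundAndRobust ψ lam r ε δ k N}

end Protocol

end RobustMBQC

end

/-! A permutation-invariant state enters only through nonnegative weights w j, one for each number j
of systems orthogonal to the target (`exists_umbralEval`). An orthogonal system fails a test with
probability ν and a target system never does, so p_k and f_k are linear in w with coefficients built
from B_{j,k}(ν). Graph states matter only as unit vectors.

Soundness is thus a linear program, bounded by a dual certificate. With E = εN and B_m = B_{m,k}(ν),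
`one_sub_le_condFid` needs one z in [0, E] such that (m+1) B_m − z B_{m+1} ≤ (E − z) δ for all m.
Write B_{m+1} = B_m (1 − τ); the left side is B_m (m + 1 − z + zτ). Log-concavity passes from the
binomial weights to their iterated partial sums and yields a quadratic inequality for τ
(`exists_binomCDF_decrease`). It makes the bracket nonpositive for m ≤ M and at most linear in m − M
beyond, where the exponential decay of B_m wins (`binomCDF_le_exp`, `soundness_inequality`). Both z
and M are placed at fixed fractions of the gap G = E − k/ν (`exists_soundness_inequality`).

Robustness is a Chernoff bound for the upper tail (`one_sub_exp_le_binomCDF`). With c = λ√(2ν) and t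
= (1−r)/(c+1), the choice k ≈ (1−t)νE leaves the relative margin t for soundness and 1 − t − r = ct
for robustness. This c lets both follow from L + 4λν² ≤ (λνt)²E, L = ln δ⁻¹, which is the hypothesis
on N; the summand 4λν² absorbs lower-order terms. -/

namespace RobustMBQC

/-! ### Binomial distribution: recursions and Chernoff bounds -/

/-- The probability of `j` successes in `m` independent trials of success probability `p`. -/
def binomWeight (m j : ℕ) (p : ℝ) : ℝ := (m.choose j : ℝ) * p ^ j * (1 - p) ^ (m - j)

lemma binomCDF_zero_right (m : ℕ) (p : ℝ) : binomCDF m 0 p = (1 - p) ^ m := by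
  simp [binomCDF]

lemma binomCDF_zero_left (k : ℕ) (p : ℝ) : binomCDF 0 k p = 1 := by
  rw [binomCDF, Finset.sum_eq_single 0] <;> simp
  intro b _ hb
  left
  exact Nat.choose_eq_zero_of_lt (Nat.pos_of_ne_zero hb)

lemma binomCDF_succ_right (m k : ℕ) (p : ℝ) :
    binomCDF m (k + 1) p = binomCDF m k p + binomWeight m (k + 1) p := by
  rw [binomCDF, Finset.sum_range_succ]; rfl

lemma binomWeight_nonneg {p : ℝ} (hp0 : 0 ≤ p) (hp1 : p ≤ 1) (m j : ℕ) :
    0 ≤ binomWeight m j p := by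
  have : 0 ≤ 1 - p := by linarith
  unfold binomWeight; positivity

lemma binomWeight_pos {p : ℝ} (hp0 : 0 < p) (hp1 : p < 1) {m j : ℕ} (h : j ≤ m) :
    0 < binomWeight m j p := by
  have h1 : 0 < 1 - p := by linarith
  have h2 : (0 : ℝ) < m.choose j := by exact_mod_cast Nat.choose_pos h
  unfold binomWeight; positivity

lemma binomWeight_of_lt {m j : ℕ} (h : m < j) (p : ℝ) : binomWeight m j p = 0 := by
  simp [binomWeight, Nat.choose_eq_zero_of_lt h]

lemma binomWeight_succ_right (m k : ℕ) (p : ℝ) :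
    (k + 1 : ℝ) * (1 - p) * binomWeight m (k + 1) p = p * (m - k) * binomWeight m k p := by
  rcases lt_trichotomy k m with h | h | h
  · have h1 : (m.choose (k + 1) : ℝ) * (k + 1) = m.choose k * (m - k) := by
      have := Nat.choose_succ_right_eq m k
      rw [← Nat.cast_sub h.le]
      exact_mod_cast this
    obtain ⟨l, rfl⟩ := Nat.exists_eq_add_of_lt h
    have h2 : k + l + 1 - k = l + 1 := by omega
    have h3 : k + l + 1 - (k + 1) = l := by omega
    unfold binomWeight
    rw [h2, h3]
    linear_combination p ^ (k + 1) * (1 - p) ^ (l + 1) * h1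
  · subst h
    rw [binomWeight_of_lt (Nat.lt_succ_self _)]; simp
  · rw [binomWeight_of_lt h, binomWeight_of_lt (by omega)]; simp

lemma binomWeight_succ_succ (m k : ℕ) (p : ℝ) :
    binomWeight (m + 1) (k + 1) p = (1 - p) * binomWeight m (k + 1) p + p * binomWeight m k p := by
  unfold binomWeight
  rw [Nat.choose_succ_succ, Nat.add_sub_add_right]
  rcases lt_or_ge k m with h | h
  · obtain ⟨l, rfl⟩ := Nat.exists_eq_add_of_lt h
    have h2 : k + l + 1 - k = l + 1 := by omega
    have h3 : k + l + 1 - (k + 1) = l := by omega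
    rw [h2, h3]; push_cast; ring
  · rw [Nat.choose_eq_zero_of_lt (show m < k + 1 by omega)]; push_cast; ring

lemma binomCDF_succ_left (m k : ℕ) (p : ℝ) :
    binomCDF (m + 1) k p = binomCDF m k p - p * binomWeight m k p := by
  induction k with
  | zero => simp [binomCDF_zero_right, binomWeight, pow_succ]; ring
  | succ k ih => rw [binomCDF_succ_right, ih, binomWeight_succ_succ, binomCDF_succ_right]; ring

lemma binomCDF_succ_succ (m k : ℕ) (p : ℝ) :
    binomCDF (m + 1) (k + 1) p = (1 - p) * binomCDF m (k + 1) p + p * binomCDF m k p := by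
  rw [binomCDF_succ_left, binomCDF_succ_right]; ring

lemma binomCDF_pos {p : ℝ} (hp0 : 0 ≤ p) (hp1 : p < 1) (m k : ℕ) : 0 < binomCDF m k p := by
  induction k with
  | zero => rw [binomCDF_zero_right]; exact pow_pos (by linarith) _
  | succ k ih =>
    rw [binomCDF_succ_right]
    linarith [binomWeight_nonneg hp0 hp1.le m (k + 1)]

/-- Chernoff bound for the lower tail, before the choice of the parameter. -/
lemma binomCDF_le_chernoff {p y : ℝ} (hp0 : 0 ≤ p) (hp1 : p ≤ 1) (hy0 : 0 < y) (hy1 : y ≤ 1)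
    (m k : ℕ) : binomCDF m k p ≤ (y ^ k)⁻¹ * (1 - p + p * y) ^ m := by
  induction m generalizing k with
  | zero =>
    rw [binomCDF_zero_left, pow_zero, mul_one]
    exact (one_le_inv₀ (pow_pos hy0 k)).2 (pow_le_one₀ hy0.le hy1)
  | succ m ih =>
    cases k with
    | zero =>
      rw [binomCDF_zero_right, pow_zero, inv_one, one_mul]
      exact pow_le_pow_left₀ (by linarith) (by nlinarith) _
    | succ k =>
      have h1 : 0 ≤ 1 - p := by linarith
      calc binomCDF (m + 1) (k + 1) p
          = (1 - p) * binomCDF m (k + 1) p + p * binomCDF m k p := binomCDF_succ_succ m k p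
        _ ≤ (1 - p) * ((y ^ (k + 1))⁻¹ * (1 - p + p * y) ^ m)
            + p * ((y ^ k)⁻¹ * (1 - p + p * y) ^ m) := by gcongr <;> apply ih
        _ = _ := by field_simp; ring

/-- Chernoff bound for the upper tail, before the choice of the parameter. -/
lemma one_sub_binomCDF_le_chernoff {p y : ℝ} (hp0 : 0 ≤ p) (hp1 : p ≤ 1) (hy1 : 1 ≤ y)
    (m k : ℕ) : 1 - binomCDF m k p ≤ (y ^ (k + 1))⁻¹ * (1 - p + p * y) ^ m := by
  have hy0 : 0 < y := by linarith
  have h1 : 0 ≤ 1 - p := by linarith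
  have hq : 1 ≤ 1 - p + p * y := by nlinarith
  induction m generalizing k with
  | zero =>
    rw [binomCDF_zero_left]
    simp only [sub_self]; positivity
  | succ m ih =>
    cases k with
    | zero =>
      calc 1 - binomCDF (m + 1) 0 p = (1 - p) * (1 - binomCDF m 0 p) + p * 1 := by
            rw [binomCDF_zero_right, binomCDF_zero_right]; ring
        _ ≤ (1 - p) * ((y ^ (0 + 1))⁻¹ * (1 - p + p * y) ^ m) + p * (1 - p + p * y) ^ m := by
            gcongr
            · apply ih
            · exact one_le_pow₀ hq
        _ = _ := by field_simp; ring
    | succ k =>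
      calc 1 - binomCDF (m + 1) (k + 1) p
          = (1 - p) * (1 - binomCDF m (k + 1) p) + p * (1 - binomCDF m k p) := by
            rw [binomCDF_succ_succ]; ring
        _ ≤ (1 - p) * ((y ^ (k + 1 + 1))⁻¹ * (1 - p + p * y) ^ m)
            + p * ((y ^ (k + 1))⁻¹ * (1 - p + p * y) ^ m) := by gcongr <;> apply ih
        _ = _ := by field_simp; ring

/-! ### Log-concavity of iterated partial sums -/

/-- The summed lower distribution function in terms of the distribution function. -/
lemma sum_binomCDF_eq (m k : ℕ) (p : ℝ) :
    ∑ i ∈ Finset.range k, binomCDF m i p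
      = p * (m - k) * binomWeight m k p - (m * p - k) * binomCDF m k p := by
  induction k with
  | zero => simp [binomCDF_zero_right, binomWeight]; ring
  | succ k ih =>
    rw [Finset.sum_range_succ, ih, binomCDF_succ_right]
    have := binomWeight_succ_right m k p
    push_cast
    linear_combination -this

/-- The ratio of consecutive weights, p(m−k) / ((k+1)(1−p)), decreases in k. -/
lemma binomWeight_logConcave {p : ℝ} (hp0 : 0 < p) (hp1 : p < 1) (m k : ℕ) :
    binomWeight m (k + 2) p * binomWeight m k p ≤ binomWeight m (k + 1) p ^ 2 := by
  rcases lt_or_ge m (k + 2) with h | h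
  · rw [binomWeight_of_lt h, zero_mul]; positivity
  have h1 := binomWeight_succ_right m k p
  have h2 := binomWeight_succ_right m (k + 1) p
  have hq : 0 < 1 - p := by linarith
  have w0 := binomWeight_pos hp0 hp1 (show k ≤ m by omega)
  have w1 := binomWeight_pos hp0 hp1 (show k + 1 ≤ m by omega)
  push_cast at h2
  have hm : (0 : ℝ) < m - (k + 1) := by
    have : ((k + 2 : ℕ) : ℝ) ≤ m := by exact_mod_cast h
    push_cast at this; linarith
  have e2 : binomWeight m (k + 2) p
      = p * (m - (k + 1)) * binomWeight m (k + 1) p / ((k + 1 + 1) * (1 - p)) := by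
    rw [eq_div_iff (by positivity)]; linear_combination h2
  have e0 : binomWeight m k p
      = (k + 1) * (1 - p) * binomWeight m (k + 1) p / (p * (m - k)) := by
    rw [eq_div_iff (mul_pos hp0 (by linarith)).ne']; linear_combination -h1
  have : binomWeight m (k + 2) p * binomWeight m k p = binomWeight m (k + 1) p ^ 2 *
      (((m - (k + 1)) * (k + 1)) / ((m - k) * (k + 1 + 1))) := by
    have : (m : ℝ) - k ≠ 0 := by linarith
    rw [e2, e0]; field_simp
  rw [this]
  refine mul_le_of_le_one_right (by positivity) ?_
  rw [div_le_one (mul_pos (by linarith) (by positivity))]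
  nlinarith

/-- Adding B_{k+1} B_k to both sides shows this to be log-concavity of k ↦ B_k, inherited from the
weights. -/
lemma binomWeight_succ_mul_binomCDF_le {p : ℝ} (hp0 : 0 < p) (hp1 : p < 1) (m k : ℕ) :
    binomWeight m (k + 2) p * binomCDF m k p
      ≤ binomWeight m (k + 1) p * binomCDF m (k + 1) p := by
  induction k with
  | zero =>
    have h0 : binomCDF m 0 p = binomWeight m 0 p := by simp [binomCDF_zero_right, binomWeight]
    have h1 := binomWeight_logConcave hp0 hp1 m 0
    rw [binomCDF_succ_right, h0]
    nlinarith [mul_nonneg (binomWeight_nonneg hp0.le hp1.le m 0)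
      (binomWeight_nonneg hp0.le hp1.le m 1)]
  | succ k ih =>
    rcases lt_or_ge m (k + 3) with h | h
    · rw [binomWeight_of_lt h, zero_mul]
      exact mul_nonneg (binomWeight_nonneg hp0.le hp1.le _ _) (binomCDF_pos hp0.le hp1 _ _).le
    have w1 := binomWeight_pos hp0 hp1 (show k + 1 ≤ m by omega)
    have w2 := binomWeight_pos hp0 hp1 (show k + 2 ≤ m by omega)
    have h1 := binomWeight_logConcave hp0 hp1 m (k + 1)
    have hb := binomCDF_pos hp0.le hp1 m k
    have e : binomCDF m (k + 1) p = binomCDF m k p + binomWeight m (k + 1) p :=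
      binomCDF_succ_right m k p
    have h2 : binomWeight m (k + 3) p * binomCDF m k p
        ≤ binomWeight m (k + 2) p * binomCDF m (k + 1) p := by
      refine le_of_mul_le_mul_left ?_ w1
      calc binomWeight m (k + 1) p * (binomWeight m (k + 3) p * binomCDF m k p)
          = binomWeight m (k + 3) p * binomWeight m (k + 1) p * binomCDF m k p := by ring
        _ ≤ binomWeight m (k + 2) p ^ 2 * binomCDF m k p := by gcongr
        _ = binomWeight m (k + 2) p * (binomWeight m (k + 2) p * binomCDF m k p) := by ring
        _ ≤ binomWeight m (k + 2) p * (binomWeight m (k + 1) p * binomCDF m (k + 1) p) := by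
            gcongr
        _ = _ := by ring
    rw [binomCDF_succ_right m (k + 1)]
    calc binomWeight m (k + 1 + 2) p * binomCDF m (k + 1) p
        = binomWeight m (k + 3) p * binomCDF m k p
          + binomWeight m (k + 3) p * binomWeight m (k + 1) p := by rw [e]; ring
      _ ≤ binomWeight m (k + 2) p * binomCDF m (k + 1) p + binomWeight m (k + 2) p ^ 2 := by
          gcongr
      _ = _ := by ring

/-- This is log-concavity one summation higher, for k ↦ ∑_{i≤k} B_i, rewritten by means of b_k = B_k
− B_{k−1}. -/
lemma binomWeight_mul_sum_binomCDF_le {p : ℝ} (hp0 : 0 < p) (hp1 : p < 1) (m k : ℕ) :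
    binomWeight m k p * ∑ i ∈ Finset.range k, binomCDF m i p
      ≤ binomCDF m k p * (binomCDF m k p - binomWeight m k p) := by
  induction k with
  | zero => simp [binomCDF_zero_right, binomWeight]
  | succ k ih =>
    have hb := binomCDF_pos hp0.le hp1 m k
    rw [Finset.sum_range_succ, binomCDF_succ_right, add_sub_cancel_right]
    suffices h : binomWeight m (k + 1) p * ∑ i ∈ Finset.range k, binomCDF m i p
        ≤ binomCDF m k p * binomCDF m k p by nlinarith
    cases k with
    | zero => simp; positivity
    | succ k =>
      rcases lt_or_ge m (k + 2) with h | h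
      · rw [binomWeight_of_lt h, zero_mul]; positivity
      have w1 := binomWeight_pos hp0 hp1 (show k + 1 ≤ m by omega)
      have w2 := binomWeight_pos hp0 hp1 (show k + 2 ≤ m by omega)
      have h1 := binomWeight_succ_mul_binomCDF_le hp0 hp1 m k
      have e : binomCDF m (k + 1) p - binomWeight m (k + 1) p = binomCDF m k p := by
        rw [binomCDF_succ_right]; ring
      rw [e] at ih
      refine le_of_mul_le_mul_left ?_ w1
      calc binomWeight m (k + 1) p * (binomWeight m (k + 1 + 1) p
              * ∑ i ∈ Finset.range (k + 1), binomCDF m i p)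
          = binomWeight m (k + 2) p * (binomWeight m (k + 1) p
              * ∑ i ∈ Finset.range (k + 1), binomCDF m i p) := by ring
        _ ≤ binomWeight m (k + 2) p * (binomCDF m (k + 1) p * binomCDF m k p) := by gcongr
        _ = binomCDF m (k + 1) p * (binomWeight m (k + 2) p * binomCDF m k p) := by ring
        _ ≤ binomCDF m (k + 1) p * (binomWeight m (k + 1) p * binomCDF m (k + 1) p) := by gcongr
        _ = _ := by ring

/-- The relative decrease `τ` of `m ↦ binomCDF m k p` satisfies a quadratic inequality. -/
lemma exists_binomCDF_decrease {p : ℝ} (hp0 : 0 < p) (hp1 : p < 1) (m k : ℕ) :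
    ∃ τ : ℝ, 0 ≤ τ ∧ τ ≤ p ∧ binomCDF (m + 1) k p = binomCDF m k p * (1 - τ) ∧
      (m < k → τ = 0) ∧ τ * ((m - k) * τ - (m * p - k)) ≤ p - τ := by
  have hb := binomCDF_pos hp0.le hp1 m k
  have hw := binomWeight_nonneg hp0.le hp1.le m k
  have hwb : binomWeight m k p ≤ binomCDF m k p := by
    cases k with
    | zero => simp [binomCDF_zero_right, binomWeight]
    | succ k => rw [binomCDF_succ_right]; linarith [binomCDF_pos hp0.le hp1 m k]
  refine ⟨p * binomWeight m k p / binomCDF m k p, by positivity, ?_, ?_, ?_, ?_⟩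
  · rw [div_le_iff₀ hb]; gcongr
  · rw [binomCDF_succ_left]; field_simp
  · intro h; rw [binomWeight_of_lt h]; simp
  -- For τ = p b_k / B_k the quadratic inequality is this bound times p / B_k², with the sum in
  -- closed form.
  · have h := binomWeight_mul_sum_binomCDF_le hp0 hp1 m k
    rw [sum_binomCDF_eq] at h
    have e1 : p * binomWeight m k p / binomCDF m k p *
        ((m - k) * (p * binomWeight m k p / binomCDF m k p) - (m * p - k))
        = p * (binomWeight m k p * (p * (m - k) * binomWeight m k p
            - (m * p - k) * binomCDF m k p)) / binomCDF m k p ^ 2 := by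
      field_simp
    have e2 : p - p * binomWeight m k p / binomCDF m k p
        = p * (binomCDF m k p * (binomCDF m k p - binomWeight m k p)) / binomCDF m k p ^ 2 := by
      field_simp
    rw [e1, e2]
    gcongr

end RobustMBQC

/-! ### Lower tail and the scalar soundness inequality -/

namespace RobustMBQC

lemma sub_inv_div_two_le_log {z : ℝ} (hz0 : 0 < z) (hz1 : z ≤ 1) : (z - z⁻¹) / 2 ≤ Real.log z := by
  have h : Real.sinh (Real.log z) ≤ Real.log z := Real.sinh_le_self_iff.2 (Real.log_nonpos hz0.le hz1)
  rwa [Real.sinh_log hz0] at h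

lemma mul_exp_neg_mul_le {c : ℝ} (hc : 0 < c) (x : ℝ) :
    x * Real.exp (-(c * x)) ≤ 1 / (Real.exp 1 * c) := by
  have h := Real.add_one_le_exp (c * x - 1)
  rw [Real.exp_sub, le_div_iff₀ (Real.exp_pos 1)] at h
  rw [Real.exp_neg, ← div_eq_mul_inv, div_le_div_iff₀ (Real.exp_pos _) (by positivity)]
  linarith

/-- A lower bound for the relative entropy of Bernoulli distributions, `M` times the entropy of
`k / M` relative to `p`. -/
lemma relEntropy_lower_bound {p M k : ℝ} (hp0 : 0 < p) (hp1 : p < 1) (hk0 : 0 < k)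
    (hkM : k < p * M) :
    M * Real.log ((1 - p) * M / (M - k)) - k * Real.log ((1 - p) * k / (p * (M - k)))
      ≤ -((p * M - k) ^ 2 / (2 * p * (M - k))) := by
  have hq : 0 < 1 - p := by linarith
  have hM : 0 < M := by by_contra h; nlinarith
  have hMk : 0 < M - k := by nlinarith
  have e : (1 - p) * k / (p * (M - k)) = (k / (p * M)) * ((1 - p) * M / (M - k)) := by
    field_simp
  rw [e, Real.log_mul (by positivity) (by positivity)]
  -- The first-order terms of the two logarithm bounds cancel, leaving (pM−k)² times two reciprocals
  -- (`e5`). Having M − k in the final denominator matters: for k near pM, p(M−k) is the variance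
  -- p(1−p)M.
  have h1 := sub_inv_div_two_le_log (z := k / (p * M)) (by positivity)
    ((div_le_one (by positivity)).2 hkM.le)
  have h2 := Real.le_log_one_add_of_nonneg (x := (p * M - k) / ((1 - p) * M))
    (div_nonneg (by linarith) (by positivity))
  have e2 : 1 + (p * M - k) / ((1 - p) * M) = ((1 - p) * M / (M - k))⁻¹ := by
    field_simp; ring
  rw [e2, Real.log_inv] at h2
  have hd : 0 < 2 * (M - k) - (p * M - k) := by nlinarith
  have e3 : 2 * ((p * M - k) / ((1 - p) * M)) / ((p * M - k) / ((1 - p) * M) + 2)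
      = 2 * (p * M - k) / (2 * (M - k) - (p * M - k)) := by
    have : (p * M - k) / ((1 - p) * M) + 2
      = (2 * (M - k) - (p * M - k)) / ((1 - p) * M) := by field_simp; ring
    rw [this]; field_simp
  have e4 : k * ((k / (p * M) - (k / (p * M))⁻¹) / 2)
      = -((p * M - k) * (p * M + k) / (2 * (p * M))) := by field_simp; ring
  rw [e3] at h2
  have h1' := mul_le_mul_of_nonneg_left h1 hk0.le
  rw [e4] at h1'
  have h2' := mul_le_mul_of_nonneg_left h2 hMk.le
  have h3 : (p * M - k) ^ 2 / (2 * p * (M - k)) ≤ (M - k) * (2 * (p * M - k) /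
      (2 * (M - k) - (p * M - k))) - (p * M - k) * (p * M + k) / (2 * (p * M)) := by
    have e5 : (M - k) * (2 * (p * M - k) / (2 * (M - k) - (p * M - k)))
        - (p * M - k) * (p * M + k) / (2 * (p * M))
        = (p * M - k) ^ 2 * (1 / (2 * (M - k) - (p * M - k)) + 1 / (2 * (p * M))) := by
      obtain ⟨D, hD⟩ : ∃ D, D = 2 * (M - k) - (p * M - k) := ⟨_, rfl⟩
      rw [← hD] at hd ⊢
      have hMkD : M - k = (D + (p * M - k)) / 2 := by rw [hD]; ring
      rw [hMkD]
      field_simp; ring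
    have e6 : (p * M - k) ^ 2 / (2 * p * (M - k)) = (p * M - k) ^ 2 * (1 / (2 * p * (M - k))) := by
      field_simp
    rw [e5, e6]
    gcongr
    have h7 : 1 / (2 * (M - k)) ≤ 1 / (2 * (M - k) - (p * M - k)) := by
      apply one_div_le_one_div_of_le hd; linarith
    have h8 : 1 / (2 * p * (M - k)) ≤ 1 / (2 * (M - k)) + 1 / (2 * (p * M)) := by
      rw [div_add_div _ _ (by positivity) (by positivity),
        div_le_div_iff₀ (by positivity) (by positivity)]
      nlinarith [mul_pos (mul_pos hp0 hMk) (sub_pos.2 hkM), mul_pos hp0 hMk]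
    linarith
  nlinarith

lemma one_sub_le_neg_log {z : ℝ} (hz0 : 0 < z) (hz1 : z ≤ 1) :
    (1 - z) + (1 - z) ^ 2 / 2 ≤ -Real.log z := by
  have h1 : 1 ≤ z⁻¹ := (one_le_inv₀ hz0).2 hz1
  have h := Real.le_log_one_add_of_nonneg (x := z⁻¹ - 1) (by linarith)
  rw [add_sub_cancel, Real.log_inv] at h
  refine le_trans ?_ h
  have e : 2 * (z⁻¹ - 1) / (z⁻¹ - 1 + 2) = 2 * (1 - z) / (1 + z) := by
    have : z⁻¹ - 1 + 2 = (1 + z) / z := by field_simp; ring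
    rw [this]; field_simp
  rw [e, le_div_iff₀ (by linarith)]
  nlinarith [mul_nonneg (sub_nonneg.2 hz1) (sq_nonneg (1 - z))]

/-- Exponential decay of `m ↦ binomCDF m k p` beyond the real number `M`. -/
lemma binomCDF_le_exp {p M : ℝ} (hp0 : 0 < p) (hp1 : p < 1) {m k : ℕ} (hkM : k < p * M)
    (hm : M ≤ m) :
    binomCDF m k p ≤ Real.exp (-((p * M - k) ^ 2 / (2 * p * (M - k))))
      * Real.exp (-((p * M - k) / (M - k) * (m - M))) := by
  have hq : 0 < 1 - p := by linarith
  have hM : 0 < M := by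
    by_contra h
    nlinarith [(Nat.cast_nonneg k : (0 : ℝ) ≤ k)]
  have hMk : 0 < M - k := by nlinarith
  rw [← Real.exp_add]
  rcases Nat.eq_zero_or_pos k with rfl | hk
  · rw [binomCDF_zero_right]
    have h1 : 1 - p ≤ Real.exp (-p) := by linarith [Real.add_one_le_exp (-p)]
    calc (1 - p) ^ m ≤ Real.exp (-p) ^ m := pow_le_pow_left₀ hq.le h1 _
      _ = Real.exp (m * -p) := by rw [Real.exp_nat_mul]
      _ ≤ _ := by
        apply Real.exp_le_exp.2
        have e1 : (p * M - ((0 : ℕ) : ℝ)) ^ 2 / (2 * p * (M - ((0 : ℕ) : ℝ))) = p * M / 2 := by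
          rw [Nat.cast_zero, sub_zero, sub_zero]; field_simp
        have e2 : (p * M - ((0 : ℕ) : ℝ)) / (M - ((0 : ℕ) : ℝ)) = p := by
          rw [Nat.cast_zero, sub_zero, sub_zero]; field_simp
        rw [e1, e2]
        nlinarith [mul_pos hp0 hM]
  · have hk0 : (0 : ℝ) < k := by exact_mod_cast hk
    -- This y is the optimal Chernoff parameter for M trials, kept for every m ≥ M; the m − M
    -- further trials then contribute a geometric factor. For k = 0 it would be 0, hence the
    -- separate case.
    have hy0 : 0 < (1 - p) * k / (p * (M - k)) := by positivity
    have hy1 : (1 - p) * k / (p * (M - k)) ≤ 1 := by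
      rw [div_le_one (by positivity)]; nlinarith
    have hqe : 1 - p + p * ((1 - p) * k / (p * (M - k))) = (1 - p) * M / (M - k) := by
      field_simp; ring
    have hQ : 0 < (1 - p) * M / (M - k) := by positivity
    refine (binomCDF_le_chernoff hp0.le hp1.le hy0 hy1 m k).trans ?_
    rw [hqe, ← Real.exp_log (inv_pos.2 (pow_pos hy0 k)), ← Real.exp_log (pow_pos hQ m),
      ← Real.exp_add, Real.exp_le_exp, Real.log_inv, Real.log_pow, Real.log_pow]
    have h1 := relEntropy_lower_bound hp0 hp1 hk0 hkM
    have h2 : Real.log ((1 - p) * M / (M - k)) ≤ -((p * M - k) / (M - k)) := by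
      have h3 := Real.log_le_sub_one_of_pos hQ
      have e : (1 - p) * M / (M - k) - 1 = -((p * M - k) / (M - k)) := by field_simp; ring
      rwa [e] at h3
    nlinarith [mul_le_mul_of_nonneg_left h2 (sub_nonneg.2 hm)]

/-- The value τ' = (z−M−1)/z is the zero of m + 1 − z + zτ at m = M. Hypothesis `h1` is the
quadratic inequality reversed at (M, τ'), so that it bars τ from exceeding τ'; `h2` is what remains
for m > M after maximizing x·exp(−cx). -/
lemma soundness_inequality {p M z E δ : ℝ} (hp0 : 0 < p) (hp1 : p < 1) {k : ℕ}
    (hkM : k < p * M) (hzM : M + 1 < z) (hzE : z ≤ E) (hδ : 0 ≤ δ)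
    (h1 : p - (z - M - 1) / z ≤ (z - M - 1) / z * ((M - k) * ((z - M - 1) / z) - (M * p - k)))
    (h2 : Real.exp (-((p * M - k) ^ 2 / (2 * p * (M - k)))) * (M - k + z * p)
      ≤ Real.exp 1 * (p * M - k) * ((E - z) * δ)) (m : ℕ) :
    (m + 1) * binomCDF m k p - z * binomCDF (m + 1) k p ≤ (E - z) * δ := by
  have hM : 0 < M := by
    by_contra h
    nlinarith [(Nat.cast_nonneg k : (0 : ℝ) ≤ k)]
  have hMk : 0 < M - k := by nlinarith
  have hz : 0 < z := by linarith
  obtain ⟨τ, hτ0, hτp, hτ, hτk, hq⟩ := exists_binomCDF_decrease hp0 hp1 m k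
  have hb := binomCDF_pos hp0.le hp1 m k
  set τ' := (z - M - 1) / z with hτ'
  have hτ'0 : 0 < τ' := div_pos (by linarith) hz
  have hzτ : z * τ' = z - M - 1 := by rw [hτ']; field_simp
  have hr : 0 ≤ (E - z) * δ := mul_nonneg (by linarith) hδ
  -- With F and F' the two brackets, 0 < F' ≤ F would give τF > τ'F' ≥ p − τ' > p − τ, against `hq`.
  have key : τ' < τ → (M - k) * τ' - (M * p - k) ≤ (m - k) * τ - (m * p - k) → False := by
    intro ha hF
    have hF0 : 0 < (M - k) * τ' - (M * p - k) := by
      by_contra hc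
      nlinarith
    nlinarith [mul_lt_mul_of_pos_right ha hF0, mul_le_mul_of_nonneg_left hF hτ0]
  have e : (m + 1) * binomCDF m k p - z * binomCDF (m + 1) k p
      = binomCDF m k p * (m + 1 - z + z * τ) := by rw [hτ]; ring
  rw [e]
  rcases le_or_gt (m : ℝ) M with hm | hm
  · have : τ ≤ τ' := by
      by_contra hc
      push Not at hc
      have hkm : k ≤ m := by
        by_contra hlt
        have := hτk (by omega)
        linarith
      have hkm' : (k : ℝ) ≤ m := by exact_mod_cast hkm
      refine key hc ?_
      -- The bracket (m−k)τ − (mp−k) increases in τ for m ≥ k and, since τ ≤ p, decreases in m.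
      nlinarith [mul_le_mul_of_nonneg_left hc.le (sub_nonneg.2 hkm'),
        mul_nonneg (sub_nonneg.2 hm) (sub_nonneg.2 (hc.le.trans hτp))]
    refine le_trans (mul_nonpos_of_nonneg_of_nonpos hb.le ?_) hr
    nlinarith
  · have hτle : τ ≤ τ' + p * (m - M) / (M - k) := by
      by_contra hc
      push Not at hc
      have h3 : 0 ≤ p * (m - M) / (M - k) :=
        div_nonneg (mul_nonneg hp0.le (by linarith)) hMk.le
      have h4 : (M - k) * (p * (m - M) / (M - k)) = p * (m - M) := by field_simp
      refine key (by linarith) ?_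
      nlinarith [mul_le_mul_of_nonneg_left hc.le hMk.le,
        mul_nonneg (sub_nonneg.2 hm.le) hτ0]
    have hc0 : 0 < (p * M - k) / (M - k) := div_pos (by linarith) hMk
    have hβ : 0 ≤ 1 + z * p / (M - k) := by positivity
    have hexp := mul_exp_neg_mul_le hc0 (m - M)
    calc binomCDF m k p * (m + 1 - z + z * τ)
        ≤ binomCDF m k p * ((m - M) * (1 + z * p / (M - k))) := by
          gcongr
          have := mul_le_mul_of_nonneg_left hτle hz.le
          have e1 : z * (τ' + p * (m - M) / (M - k))
            = z * τ' + (m - M) * (z * p / (M - k)) := by ring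
          rw [e1, hzτ] at this
          linarith
      _ ≤ (Real.exp (-((p * M - k) ^ 2 / (2 * p * (M - k))))
            * Real.exp (-((p * M - k) / (M - k) * (m - M))))
            * ((m - M) * (1 + z * p / (M - k))) := by
          refine mul_le_mul_of_nonneg_right (binomCDF_le_exp hp0 hp1 hkM hm.le) ?_
          exact mul_nonneg (by linarith) hβ
      _ = Real.exp (-((p * M - k) ^ 2 / (2 * p * (M - k)))) * (1 + z * p / (M - k))
            * ((m - M) * Real.exp (-((p * M - k) / (M - k) * (m - M)))) := by ring
      _ ≤ Real.exp (-((p * M - k) ^ 2 / (2 * p * (M - k)))) * (1 + z * p / (M - k))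
            * (1 / (Real.exp 1 * ((p * M - k) / (M - k)))) := by gcongr
      _ = Real.exp (-((p * M - k) ^ 2 / (2 * p * (M - k)))) * (M - k + z * p)
            / (Real.exp 1 * (p * M - k)) := by
          have : p * M - k ≠ 0 := by linarith
          field_simp
      _ ≤ (E - z) * δ := by
          rw [div_le_iff₀ (mul_pos (Real.exp_pos 1) (by linarith))]
          linarith

/-! ### Choice of z and M -/

lemma four_mul_le_of_mul_le {ν lam : ℝ} (hν : 0 < ν) (hlam : 0 < lam) (hs : lam + ν = 1) :
    4 * (lam * ν) * (4 / 10) ≤ (69 / 100) * (1 - 4 * (lam * ν)) + 4 * (lam * ν) * ν := by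
  obtain rfl : lam = 1 - ν := by linarith
  rcases le_or_gt (4 / 10) ν with h | h
  · nlinarith [mul_nonneg (mul_pos hlam hν).le (sub_nonneg.2 h), sq_nonneg (1 - 2 * ν)]
  · nlinarith [mul_nonneg (sq_nonneg (1 - 2 * ν)) (sub_nonneg.2 h.le), sq_nonneg (ν - 32 / 100)]

/-- With W the displayed quotient, W/4 − L = L(1/(4λν) − 1) + ν ≥ 0.4: the ν, due to the summand
4λν², suffices when λν is near 1/4, and the first term takes over for small ν. Then exp X ≥ 1 + X
for X = W/4 − L is enough. -/
lemma exp_neg_le_of_weight {ν lam L : ℝ} (hν : 0 < ν) (hlam : 0 < lam) (hs : lam + ν = 1)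
    (hL : 69 / 100 ≤ L) :
    Real.exp (-((L + 4 * lam * ν ^ 2) / (lam * ν) / 4))
      ≤ Real.exp 1 * (71 / 100) * (9 / 100) * ((L + 4 * lam * ν ^ 2) / (lam * ν))
        * Real.exp (-L) := by
  set W := (L + 4 * lam * ν ^ 2) / (lam * ν) with hW
  have hX : 4 / 10 ≤ W / 4 - L := by
    have hp : 0 < lam * ν := mul_pos hlam hν
    rw [hW, div_div, le_sub_iff_add_le, le_div_iff₀ (by positivity)]
    have h4 : 4 * (lam * ν) ≤ 1 := by nlinarith [sq_nonneg (lam - ν)]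
    nlinarith [four_mul_le_of_mul_le hν hlam hs]
  set X := W / 4 - L with hXdef
  have eW : W = 4 * (X + L) := by rw [hXdef]; ring
  have e1 : -(W / 4) = -X + -L := by rw [hXdef]; ring
  rw [e1, Real.exp_add]
  gcongr
  rw [Real.exp_neg, inv_le_comm₀ (Real.exp_pos _) (by rw [eW]; positivity)]
  refine le_trans ?_ (Real.add_one_le_exp X)
  have he : 2.718 ≤ Real.exp 1 := by linarith [Real.exp_one_gt_d9]
  rw [inv_le_comm₀ (by rw [eW]; positivity) (by linarith), eW]
  rw [inv_le_iff_one_le_mul₀ (by linarith)]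
  have h5 : 1 ≤ 2.718 * (71 / 100) * (9 / 100) * (4 * (X + L)) * (X + 1) := by
    nlinarith [mul_nonneg (sub_nonneg.2 hX) (sub_nonneg.2 hL)]
  refine h5.trans ?_
  gcongr

/-- This is `hH` of `quadratic_condition` for Z = 0.91G, a = 0.71λG, multiplied by Z. After
multiplication by λν², `hQ` bounds the right side below by 0.182(L + 4λν²)(S + G), which dominates
the left side separately in S and in G. -/
lemma gap_lower_bound {lam ν E L G S : ℝ} (hν : 0 < ν) (hlam : 0 < lam)
    (hs : lam + ν = 1) (hL : 69 / 100 ≤ L) (hS0 : 0 ≤ S) (hG0 : 0 < G)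
    (hG : E = S + G) (hQ : (L + 4 * lam * ν ^ 2) * E ≤ (lam * ν * G) ^ 2) :
    (1 + lam) * (91 / 100 * G) + S ≤ lam * (20 / 100 * G) * (91 / 100 * G) := by
  have hln : lam * ν ≤ 1 / 4 := by nlinarith [sq_nonneg (lam - ν)]
  have hp : 0 < lam * ν := mul_pos hlam hν
  obtain ⟨v, hv⟩ : ∃ v, v = lam * ν ^ 2 := ⟨_, rfl⟩
  have hv0 : 0 < v := by rw [hv]; positivity
  have hv1 : v ≤ 1 / 4 := by
    have : v = lam * ν * ν := by rw [hv]; ring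
    nlinarith
  have hvl : v * lam ≤ 1 / 16 := by
    have : v * lam = (lam * ν) ^ 2 := by rw [hv]; ring
    nlinarith
  have hQ' : (L + 4 * v) * E ≤ lam * v * G ^ 2 := by
    have e1 : (lam * ν * G) ^ 2 = lam * v * G ^ 2 := by rw [hv]; ring
    have e2 : 4 * lam * ν ^ 2 = 4 * v := by rw [hv]; ring
    rwa [e1, e2] at hQ
  refine le_of_mul_le_mul_left ?_ hv0
  have h1 : v * (lam * (20 / 100 * G) * (91 / 100 * G)) = 182 / 1000 * (lam * v * G ^ 2) := by ring
  have h2 : v * ((1 + lam) * (91 / 100 * G) + S) ≤ 182 / 1000 * ((L + 4 * v) * E) := by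
    have a0 : v ≤ 182 / 1000 * (L + 4 * v) := by linarith
    have a1 := mul_le_mul_of_nonneg_right a0 hS0
    have a2 : v * (1 + lam) * (91 / 100) ≤ 182 / 1000 * (L + 4 * v) := by linarith
    have a3 := mul_le_mul_of_nonneg_right a2 hG0.le
    rw [hG]
    linarith
  linarith

/-- Here k = νS, M = S + a, z = S + Z. Since R = Z − a − 1 ≥ νZ, the deficit νz − R is at most νS,
while `hH` makes the remaining bracket at least S(S+Z)/Z. -/
lemma quadratic_condition {lam ν S Z a : ℝ} (hν : 0 < ν) (hlam : 0 < lam) (hs : lam + ν = 1)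
    (hS0 : 0 ≤ S) (hZ0 : 0 < Z) (ha0 : 0 < a) (hH : 1 + lam + S / Z ≤ lam * Z - a) :
    ν - (S + Z - (S + a) - 1) / (S + Z) ≤ (S + Z - (S + a) - 1) / (S + Z) *
      ((lam * S + a) * ((S + Z - (S + a) - 1) / (S + Z)) - ν * a) := by
  have hSZ : 0 ≤ S / Z := by positivity
  obtain ⟨R, hRdef⟩ : ∃ R, R = S + Z - (S + a) - 1 := ⟨_, rfl⟩
  have hR : ν * Z ≤ R := by
    obtain rfl : ν = 1 - lam := by linarith
    linarith
  rw [← hRdef]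
  have hR0 : 0 < R := lt_of_lt_of_le (by positivity) hR
  have e1 : ν - R / (S + Z) = (S + Z) * (ν * (S + Z) - R) / (S + Z) ^ 2 := by
    field_simp
  have e2 : R / (S + Z) * ((lam * S + a) * (R / (S + Z)) - ν * a)
      = R * ((lam * S + a) * R - ν * a * (S + Z)) / (S + Z) ^ 2 := by
    field_simp
  have e3 : (lam * S + a) * R - ν * a * (S + Z) = (lam * Z - a) * (S + a) - (lam * S + a) := by
    rw [hRdef]; obtain rfl : ν = 1 - lam := by linarith
    ring
  have h3 : S * (S + Z) / Z ≤ (lam * Z - a) * (S + a) - (lam * S + a) := by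
    have h4 := mul_le_mul_of_nonneg_right hH (by linarith : 0 ≤ S + a)
    have e4 : S * (S + Z) / Z = S / Z * S + S := by field_simp
    rw [e4]
    linarith [mul_nonneg hSZ ha0.le, mul_pos hlam ha0]
  have h5 : ν * (S + Z) - R ≤ ν * S := by linarith
  rw [e1, e2, e3]
  refine div_le_div_of_nonneg_right ?_ (by positivity)
  calc (S + Z) * (ν * (S + Z) - R) ≤ (S + Z) * (ν * S) :=
        mul_le_mul_of_nonneg_left h5 (by positivity)
    _ = ν * Z * (S * (S + Z) / Z) := by field_simp
    _ ≤ R * (S * (S + Z) / Z) := mul_le_mul_of_nonneg_right hR (by positivity)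
    _ ≤ _ := mul_le_mul_of_nonneg_left h3 hR0.le

lemma exponential_condition {lam ν E L G S : ℝ} (hν : 0 < ν) (hlam : 0 < lam)
    (hs : lam + ν = 1) (hL : 69 / 100 ≤ L) (hS0 : 0 ≤ S) (hG0 : 0 < G)
    (hG : E = S + G) (hQ : (L + 4 * lam * ν ^ 2) * E ≤ (lam * ν * G) ^ 2) :
    Real.exp (-((ν * (lam * (71 / 100 * G))) ^ 2 / (2 * ν * (lam * S + lam * (71 / 100 * G)))))
        * (lam * S + lam * (71 / 100 * G) + (S + 91 / 100 * G) * ν)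
      ≤ Real.exp 1 * (ν * (lam * (71 / 100 * G)))
        * ((E - (S + 91 / 100 * G)) * Real.exp (-L)) := by
  have hW := exp_neg_le_of_weight hν hlam hs hL
  have hp : 0 < lam * ν := mul_pos hlam hν
  have hE : 0 < E := by linarith
  obtain ⟨W, hWdef⟩ : ∃ W, W = (L + 4 * lam * ν ^ 2) / (lam * ν) := ⟨_, rfl⟩
  rw [← hWdef] at hW
  have hW0 : 0 ≤ W := by rw [hWdef]; positivity
  have hWE : W * E ≤ lam * ν * G ^ 2 := by
    rw [hWdef, div_mul_eq_mul_div, div_le_iff₀ hp]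
    refine hQ.trans (le_of_eq (by ring))
  have hW4 : W / 4 ≤ (ν * (lam * (71 / 100 * G))) ^ 2
      / (2 * ν * (lam * S + lam * (71 / 100 * G))) := by
    rw [div_le_div_iff₀ (by norm_num) (by positivity)]
    have h6 : lam * S + lam * (71 / 100 * G) ≤ lam * E := by
      rw [hG]; linarith [mul_pos hlam hG0]
    calc W * (2 * ν * (lam * S + lam * (71 / 100 * G))) ≤ W * (2 * ν * (lam * E)) := by gcongr
      _ = 2 * (lam * ν) * (W * E) := by ring
      _ ≤ 2 * (lam * ν) * (lam * ν * G ^ 2) := by gcongr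
      _ = 2 * (lam * ν * G) ^ 2 := by ring
      -- The fraction 0.71 just exceeds 1/√2.
      _ ≤ (71 / 100) ^ 2 * 4 * (lam * ν * G) ^ 2 := by
          refine mul_le_mul_of_nonneg_right (by norm_num) (by positivity)
      _ = _ := by ring
  calc Real.exp (-((ν * (lam * (71 / 100 * G))) ^ 2 / (2 * ν * (lam * S + lam * (71 / 100 * G)))))
        * (lam * S + lam * (71 / 100 * G) + (S + 91 / 100 * G) * ν)
      ≤ Real.exp (-(W / 4)) * E := by
        refine mul_le_mul (Real.exp_le_exp.2 (by linarith)) ?_ (by positivity) (by positivity)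
        obtain rfl : ν = 1 - lam := by linarith
        nlinarith
    _ ≤ Real.exp 1 * (71 / 100) * (9 / 100) * W * Real.exp (-L) * E :=
        mul_le_mul_of_nonneg_right hW hE.le
    _ = Real.exp 1 * (71 / 100) * (9 / 100) * Real.exp (-L) * (W * E) := by ring
    _ ≤ Real.exp 1 * (71 / 100) * (9 / 100) * Real.exp (-L) * (lam * ν * G ^ 2) :=
        mul_le_mul_of_nonneg_left hWE (by positivity)
    _ = _ := by rw [hG]; ring

/-- The soundness inequality holds for a suitable `z`, if the number `E` of systems times the
infidelity exceeds `k / (1 - lam)` sufficiently. -/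
lemma exists_soundness_inequality {lam ν E L G : ℝ} (hν : 0 < ν) (hlam : 0 < lam)
    (hs : lam + ν = 1) (hL : 69 / 100 ≤ L) {k : ℕ} (hG0 : 0 < G)
    (hG : E = k / ν + G) (hQ : (L + 4 * lam * ν ^ 2) * E ≤ (lam * ν * G) ^ 2) :
    ∃ z : ℝ, 0 ≤ z ∧ z ≤ E ∧ ∀ m : ℕ,
      (m + 1) * binomCDF m k ν - z * binomCDF (m + 1) k ν ≤ (E - z) * Real.exp (-L) := by
  have hk0 : (0 : ℝ) ≤ k := Nat.cast_nonneg k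
  obtain ⟨S, hS⟩ : ∃ S, S = k / ν := ⟨_, rfl⟩
  have hS0 : 0 ≤ S := by rw [hS]; positivity
  have hk : (k : ℝ) = ν * S := by rw [hS]; field_simp
  rw [← hS] at hG
  have hH := gap_lower_bound hν hlam hs hL hS0 hG0 hG hQ
  have hH1 : 1 + lam + S / (91 / 100 * G) ≤ lam * (91 / 100 * G) - lam * (71 / 100 * G) := by
    have e1 : 1 + lam + S / (91 / 100 * G)
        = ((1 + lam) * (91 / 100 * G) + S) / (91 / 100 * G) := by field_simp
    rw [e1, div_le_iff₀ (by positivity)]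
    linarith
  have hSZ : 0 ≤ S / (91 / 100 * G) := by positivity
  have ha0 : 0 < lam * (71 / 100 * G) := by positivity
  have hMk : S + lam * (71 / 100 * G) - k = lam * S + lam * (71 / 100 * G) := by
    rw [hk]; linear_combination -S * hs
  have hA : ν * (S + lam * (71 / 100 * G)) - k = ν * (lam * (71 / 100 * G)) := by rw [hk]; ring
  have hA' : (S + lam * (71 / 100 * G)) * ν - k = ν * (lam * (71 / 100 * G)) := by rw [hk]; ring
  have hlamG : lam * G < G := mul_lt_of_lt_one_left hG0 (by linarith)
  -- The remainder E − z = 0.09G serves the exponential condition, the slack 0.91 − 0.71 the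
  -- quadratic one.
  refine ⟨S + 91 / 100 * G, by positivity, by linarith, fun m => soundness_inequality
    (M := S + lam * (71 / 100 * G)) hν (by linarith) (by linarith [mul_pos hν ha0])
    (by linarith) (by linarith) (Real.exp_pos _).le ?_ ?_ m⟩
  · rw [hMk, hA']
    exact quadratic_condition hν hlam hs hS0 (by positivity) ha0 hH1
  · rw [hMk, hA]
    exact exponential_condition hν hlam hs hL hS0 hG0 hG hQ

/-! ### Upper tail, for robustness -/

/-- Chernoff bound for the upper tail of the binomial distribution. -/
lemma one_sub_exp_le_binomCDF {p x : ℝ} (hp0 : 0 ≤ p) (hp1 : p ≤ 1) {N k : ℕ}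
    (hx : N * p ≤ x) (hx0 : 0 < x) (hxk : x ≤ k + 1) :
    1 - Real.exp (-((x - N * p) ^ 2 / (2 * x))) ≤ binomCDF N k p := by
  have hNp : 0 ≤ (N : ℝ) * p := by positivity
  suffices h : 1 - binomCDF N k p ≤ Real.exp (-((x - N * p) ^ 2 / (2 * x))) by linarith
  rcases hNp.eq_or_lt with h0 | h0
  · have : binomCDF N k p = 1 := by
      rcases mul_eq_zero.1 h0.symm with h | h
      · have : N = 0 := by exact_mod_cast h
        rw [this, binomCDF_zero_left]
      · rw [h, binomCDF, Finset.sum_eq_single 0] <;> simp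
        intro b _ hb; right; exact hb
    rw [this, sub_self]; positivity
  -- The parameter y = x/(Np) minimizes y^(−x)·exp(Np(y−1)), the bound with x for k + 1 and the
  -- Poisson majorant.
  · have hy1 : 1 ≤ x / (N * p) := (one_le_div h0).2 hx
    have hy0 : 0 < x / (N * p) := by positivity
    refine (one_sub_binomCDF_le_chernoff hp0 hp1 hy1 N k).trans ?_
    have h1 : (1 - p + p * (x / (N * p))) ^ N ≤ Real.exp (x - N * p) := by
      have h2 := Real.add_one_le_exp (p * (x / (N * p)) - p)
      calc (1 - p + p * (x / (N * p))) ^ N ≤ Real.exp (p * (x / (N * p)) - p) ^ N := by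
            apply pow_le_pow_left₀ _ (by linarith)
            nlinarith
        _ = Real.exp (N * (p * (x / (N * p)) - p)) := by rw [Real.exp_nat_mul]
        _ = _ := by
          congr 1
          have : (N : ℝ) * p ≠ 0 := h0.ne'
          have hN : (N : ℝ) ≠ 0 := left_ne_zero_of_mul this
          have hp : p ≠ 0 := right_ne_zero_of_mul this
          field_simp
    have h3 : ((x / (N * p)) ^ (k + 1))⁻¹ ≤ Real.exp (-(x * Real.log (x / (N * p)))) := by
      rw [← Real.exp_log (inv_pos.2 (pow_pos hy0 (k + 1))), Real.exp_le_exp, Real.log_inv,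
        Real.log_pow]
      push_cast
      have := Real.log_nonneg hy1
      nlinarith
    refine (mul_le_mul h3 h1 (by positivity) (by positivity)).trans ?_
    rw [← Real.exp_add, Real.exp_le_exp]
    have h4 := one_sub_le_neg_log (z := N * p / x) (by positivity) ((div_le_one hx0).2 hx)
    rw [← Real.log_inv, inv_div] at h4
    have h5 := mul_le_mul_of_nonneg_left h4 hx0.le
    have e : x * (1 - N * p / x + (1 - N * p / x) ^ 2 / 2)
        = (x - N * p) + (x - N * p) ^ 2 / (2 * x) := by field_simp
    linarith

end RobustMBQC

/-! ### Permutation-invariant states and the dual certificate -/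

noncomputable section

namespace RobustMBQC

section TensorPower

variable {ι : Type*} {m : ℕ}

lemma tensorOp_conjTranspose (A : Fin m → Matrix ι ι ℂ) :
    (tensorOp A).conjTranspose = tensorOp fun j => (A j).conjTranspose := by
  ext x y
  simp [tensorOp, Matrix.conjTranspose_apply]

lemma tensorOp_one [DecidableEq ι] : tensorOp (fun _ : Fin m => (1 : Matrix ι ι ℂ)) = 1 := by
  ext x y
  simp only [tensorOp, Matrix.of_apply, Matrix.one_apply]
  by_cases h : x = y
  · simp [h]
  · obtain ⟨j, hj⟩ := Function.ne_iff.1 h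
    rw [if_neg h]
    exact Finset.prod_eq_zero (Finset.mem_univ j) (if_neg hj)

lemma isPermInvariant_tensorOp_const (A : Matrix ι ι ℂ) (m : ℕ) :
    IsPermInvariant (tensorOp fun _ : Fin m => A) := by
  intro π x y
  simp only [tensorOp, Matrix.of_apply, Function.comp_apply]
  exact Equiv.prod_comp π fun j => A (x j) (y j)

lemma tensorOp_add_smul [DecidableEq ι] (P Q : Matrix ι ι ℂ) (a b : Fin m → ℝ) :
    tensorOp (fun j => (b j : ℂ) • P + (a j : ℂ) • Q)
      = ∑ A : Finset (Fin m), (((∏ j ∈ A, a j) * ∏ j ∈ Aᶜ, b j : ℝ) : ℂ)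
          • tensorOp fun j => if j ∈ A then Q else P := by
  ext x y
  simp only [tensorOp, Matrix.sum_apply, Matrix.smul_apply, Matrix.of_apply, Matrix.add_apply,
    smul_eq_mul]
  rw [Finset.prod_congr rfl fun j _ => add_comm _ _, Finset.prod_add, Finset.powerset_univ]
  refine Finset.sum_congr rfl fun A _ => ?_
  have h : ∏ j, (if j ∈ A then Q else P) (x j) (y j)
      = (∏ j ∈ A, Q (x j) (y j)) * ∏ j ∈ Aᶜ, P (x j) (y j) := by
    rw [← Finset.prod_mul_prod_compl A]
    congr 1
    · exact Finset.prod_congr rfl fun j hj => by rw [if_pos hj]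
    · exact Finset.prod_congr rfl fun j hj => by rw [if_neg (Finset.mem_compl.1 hj)]
  rw [h, ← Finset.compl_eq_univ_sdiff, Finset.prod_mul_distrib, Finset.prod_mul_distrib]
  push_cast
  ring

variable [Fintype ι]

lemma tensorOp_mul (A B : Fin m → Matrix ι ι ℂ) :
    tensorOp A * tensorOp B = tensorOp fun j => A j * B j := by
  ext x y
  simp only [tensorOp, Matrix.mul_apply, Matrix.of_apply]
  rw [Finset.prod_univ_sum, Fintype.piFinset_univ]
  exact Finset.sum_congr rfl fun z _ => Finset.prod_mul_distrib.symm

lemma trace_tensorOp (A : Fin m → Matrix ι ι ℂ) :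
    (tensorOp A).trace = ∏ j, (A j).trace := by
  simp only [tensorOp, Matrix.trace, Matrix.diag_apply, Matrix.of_apply]
  rw [Finset.prod_univ_sum, Fintype.piFinset_univ]

lemma trace_tensorOp_mul_comp_perm {ρ : Matrix (Fin m → ι) (Fin m → ι) ℂ}
    (hρ : IsPermInvariant ρ) (A : Fin m → Matrix ι ι ℂ) (π : Equiv.Perm (Fin m)) :
    (tensorOp (A ∘ π) * ρ).trace = (tensorOp A * ρ).trace := by
  simp only [Matrix.trace, Matrix.diag_apply, Matrix.mul_apply]
  have e : ∀ x y, tensorOp (A ∘ π) (x ∘ π) (y ∘ π) = tensorOp A x y := by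
    intro x y
    simp only [tensorOp, Matrix.of_apply, Function.comp_apply]
    exact Equiv.prod_comp π fun j => A j (x j) (y j)
  have hs : ∀ f : (Fin m → ι) → ℂ, ∑ x, f (x ∘ π) = ∑ x, f x := fun f =>
    Equiv.sum_comp (Equiv.arrowCongr π.symm (Equiv.refl ι)) f
  rw [← hs]
  refine Finset.sum_congr rfl fun x _ => ?_
  rw [← hs]
  refine Finset.sum_congr rfl fun y _ => ?_
  rw [e, hρ]

lemma trace_mul_nonneg_of_projection {κ : Type*} [Fintype κ] {A ρ : Matrix κ κ ℂ}
    (hA : A.conjTranspose * A = A) (hρ : ρ.PosSemidef) : 0 ≤ (A * ρ).trace := by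
  rw [← hA, Matrix.mul_assoc, Matrix.trace_mul_comm]
  exact (hρ.mul_mul_conjTranspose_same A).trace_nonneg

end TensorPower

section Projection

variable {ι : Type*}

lemma ketBra_conjTranspose (ψ : ι → ℂ) : (ketBra ψ).conjTranspose = ketBra ψ := by
  simp [ketBra, Matrix.conjTranspose_vecMulVec]

lemma one_sub_verifOp [DecidableEq ι] (ψ : ι → ℂ) (lam : ℝ) :
    1 - verifOp ψ lam = ((0 : ℝ) : ℂ) • ketBra ψ + ((1 - lam : ℝ) : ℂ) • (1 - ketBra ψ) := by
  unfold verifOp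
  push_cast
  module

variable [Fintype ι] {ψ : ι → ℂ}

lemma trace_ketBra (hψ : star ψ ⬝ᵥ ψ = 1) : (ketBra ψ).trace = 1 := by
  rw [ketBra, Matrix.trace_vecMulVec, dotProduct_comm, hψ]

lemma ketBra_mul_self (hψ : star ψ ⬝ᵥ ψ = 1) : ketBra ψ * ketBra ψ = ketBra ψ := by
  rw [ketBra, Matrix.vecMulVec_mul_vecMulVec, hψ]
  simp

variable [DecidableEq ι]

lemma projection_ite (hψ : star ψ ⬝ᵥ ψ = 1) (p : Prop) [Decidable p] :
    (if p then 1 - ketBra ψ else ketBra ψ).conjTranspose * (if p then 1 - ketBra ψ else ketBra ψ)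
      = if p then 1 - ketBra ψ else ketBra ψ := by
  split_ifs
  · rw [Matrix.conjTranspose_sub, Matrix.conjTranspose_one, ketBra_conjTranspose]
    simp [mul_sub, sub_mul, ketBra_mul_self hψ]
  · rw [ketBra_conjTranspose, ketBra_mul_self hψ]

end Projection

section Functional

open Polynomial

/-- Evaluation of a polynomial of degree at most `m` at a sequence instead of the powers of a
number. -/
def umbralEval (m : ℕ) (w : ℕ → ℝ) : ℝ[X] →ₗ[ℝ] ℝ where
  toFun p := ∑ j ∈ Finset.range (m + 1), p.coeff j * w j
  map_add' p q := by simp [add_mul, Finset.sum_add_distrib]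
  map_smul' c p := by simp [mul_assoc, Finset.mul_sum]

lemma umbralEval_nonpos {m : ℕ} {w : ℕ → ℝ} (hw : ∀ j, 0 ≤ w j) {p : ℝ[X]}
    (hp : ∀ j ≤ m, p.coeff j ≤ 0) : umbralEval m w p ≤ 0 := by
  change ∑ j ∈ Finset.range (m + 1), p.coeff j * w j ≤ 0
  exact Finset.sum_nonpos fun j hj =>
    mul_nonpos_of_nonpos_of_nonneg (hp j (Finset.mem_range_succ_iff.1 hj)) (hw j)

lemma umbralEval_X_pow {m j : ℕ} (w : ℕ → ℝ) (h : j ≤ m) : umbralEval m w (X ^ j) = w j := by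
  simp only [umbralEval, LinearMap.coe_mk, AddHom.coe_mk, coeff_X_pow]
  simp [h]

lemma umbralEval_prod {m : ℕ} (w : ℕ → ℝ) (a b : Fin m → ℝ) :
    umbralEval m w (∏ j, (C (b j) + C (a j) * X))
      = ∑ A : Finset (Fin m), ((∏ j ∈ A, a j) * ∏ j ∈ Aᶜ, b j) * w A.card := by
  rw [Finset.prod_congr rfl fun j _ => add_comm _ _, Finset.prod_add, Finset.powerset_univ,
    map_sum]
  refine Finset.sum_congr rfl fun A _ => ?_
  have : (∏ j ∈ A, C (a j) * X) * ∏ j ∈ Finset.univ \ A, C (b j)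
      = ((∏ j ∈ A, a j) * ∏ j ∈ Aᶜ, b j) • (X : ℝ[X]) ^ A.card := by
    rw [Finset.prod_mul_distrib, Finset.prod_const, ← map_prod, ← map_prod, smul_eq_C_mul,
      map_mul, ← Finset.compl_eq_univ_sdiff]
    ring
  rw [this, map_smul, umbralEval_X_pow w (by simpa using A.card_le_univ), smul_eq_mul]

variable {ι : Type*} [Fintype ι] [DecidableEq ι] {ψ : ι → ℂ}

lemma exists_perm_mem_iff {α : Type*} [Fintype α] [DecidableEq α] {A B : Finset α}
    (h : A.card = B.card) : ∃ π : Equiv.Perm α, ∀ j, π j ∈ B ↔ j ∈ A := by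
  have e : { x // x ∈ A } ≃ { x // x ∈ B } := Finset.equivOfCardEq h
  refine ⟨e.extendSubtype, fun j => ⟨fun hj => ?_, fun hj => e.extendSubtype_mem j hj⟩⟩
  by_contra hA
  exact e.extendSubtype_not_mem j hA hj

/-- The statistics of a permutation-invariant state depends only on the distribution of the number
of systems orthogonal to the target state. -/
lemma exists_umbralEval {m : ℕ} (hψ : star ψ ⬝ᵥ ψ = 1) {ρ : Matrix (Fin m → ι) (Fin m → ι) ℂ}
    (hρ : ρ.PosSemidef) (hinv : IsPermInvariant ρ) :
    ∃ w : ℕ → ℝ, (∀ j, 0 ≤ w j) ∧ ∀ a b : Fin m → ℝ,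
      ((tensorOp (fun j => (b j : ℂ) • ketBra ψ + (a j : ℂ) • (1 - ketBra ψ)) * ρ).trace).re
        = umbralEval m w (∏ j, (C (b j) + C (a j) * X)) := by
  let W : Finset (Fin m) → ℝ := fun A =>
    ((tensorOp (fun j => if j ∈ A then 1 - ketBra ψ else ketBra ψ) * ρ).trace).re
  have hW0 : ∀ A, 0 ≤ W A := fun A => by
    refine (Complex.nonneg_iff.1 (trace_mul_nonneg_of_projection ?_ hρ)).1
    rw [tensorOp_conjTranspose, tensorOp_mul]
    congr 1
    funext j
    exact projection_ite hψ _
  have hWcard : ∀ A B : Finset (Fin m), A.card = B.card → W A = W B := by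
    intro A B h
    obtain ⟨π, hπ⟩ := exists_perm_mem_iff h
    simp only [W]
    rw [← trace_tensorOp_mul_comp_perm hinv (fun j => if j ∈ B then _ else _) π]
    congr 4
    funext j
    simp [hπ]
  -- By invariance the first j systems represent all sets of j systems.
  refine ⟨fun j => W (Finset.univ.filter fun i : Fin m => (i : ℕ) < j), fun j => hW0 _, ?_⟩
  intro a b
  rw [umbralEval_prod, tensorOp_add_smul, Finset.sum_mul, Matrix.trace_sum, Complex.re_sum]
  refine Finset.sum_congr rfl fun A _ => ?_
  rw [Matrix.smul_mul, Matrix.trace_smul, smul_eq_mul, Complex.re_ofReal_mul]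
  congr 1
  refine hWcard _ _ ?_
  rw [Fin.card_filter_val_lt]
  have := A.card_le_univ
  simp at this
  omega

/-- The generating polynomial of the acceptance probabilities. -/
def acceptPoly (lam : ℝ) (k N : ℕ) : ℝ[X] :=
  ∑ i ∈ Finset.range (k + 1),
    C (N.choose i : ℝ) * ((1 + C lam * X) ^ (N - i) * (C (1 - lam) * X) ^ i)

/-- Of N tested systems, j are orthogonal to the target, and at most k of these j may fail. -/
lemma coeff_acceptPoly {lam : ℝ} {k N : ℕ} (hk : k ≤ N) (j : ℕ) :
    (acceptPoly lam k N).coeff j = N.choose j * binomCDF j k (1 - lam) := by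
  rw [acceptPoly, finsetSum_coeff, binomCDF, Finset.mul_sum]
  refine Finset.sum_congr rfl fun i hi => ?_
  have hi' : i ≤ N := by rw [Finset.mem_range] at hi; omega
  have e1 : (1 + C lam * X : ℝ[X]) ^ (N - i) = ((1 + X) ^ (N - i) : ℝ[X]).comp (C lam * X) := by
    simp
  rw [coeff_C_mul, mul_pow, ← C_pow, mul_left_comm, coeff_C_mul, coeff_mul_X_pow', e1]
  split_ifs with hij
  · rw [comp_C_mul_X_coeff, coeff_one_add_X_pow, sub_sub_cancel]
    have h := Nat.choose_mul (n := N) hij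
    have h' : (N.choose j : ℝ) * j.choose i = N.choose i * (N - i).choose (j - i) := by
      exact_mod_cast h
    linear_combination -((1 - lam) ^ i * lam ^ (j - i)) * h'
  · rw [Nat.choose_eq_zero_of_lt (show j < i by omega)]; simp

lemma prod_range_ite {R : Type*} [CommMonoid R] (a b : R) {N i : ℕ} (h : i ≤ N) :
    ∏ j ∈ Finset.range N, (if j < N - i then a else b) = a ^ (N - i) * b ^ i := by
  obtain ⟨l, rfl⟩ := Nat.exists_eq_add_of_le' h
  rw [Finset.prod_range_add, Nat.add_sub_cancel]
  congr 1
  · rw [Finset.prod_congr rfl fun j hj => if_pos (Finset.mem_range.1 hj)]; simp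
  · rw [Finset.prod_congr rfl fun j hj => if_neg (by omega)]; simp

lemma exists_accept_eq_umbralEval {N k : ℕ} (hk : k ≤ N) (lam : ℝ) (hψ : star ψ ⬝ᵥ ψ = 1)
    {ρ : Matrix (Fin (N + 1) → ι) (Fin (N + 1) → ι) ℂ}
    (hρ : IsDensity ρ) (hinv : IsPermInvariant ρ) :
    ∃ w : ℕ → ℝ, (∀ j, 0 ≤ w j) ∧
      acceptProb ψ lam k N ρ = umbralEval (N + 1) w (acceptPoly lam k N * (1 + X)) ∧
      acceptFid ψ lam k N ρ = umbralEval (N + 1) w (acceptPoly lam k N) ∧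
      umbralEval (N + 1) w ((1 + X) ^ (N + 1)) = 1 := by
  obtain ⟨w, hw0, hw⟩ := exists_umbralEval hψ hρ.1 hinv
  -- The last factor is the identity for s = 1 and the target projection for s = 0.
  have key : ∀ (i : ℕ), i ≤ N → ∀ (s : ℝ),
      ((testOp (verifOp ψ lam) (((1 : ℝ) : ℂ) • ketBra ψ + (s : ℂ) • (1 - ketBra ψ)) N i
        * ρ).trace).re
      = umbralEval (N + 1) w
        ((1 + C lam * X) ^ (N - i) * (C (1 - lam) * X) ^ i * (1 + C s * X)) := by
    intro i hi s
    let a : Fin (N + 1) → ℝ := fun j =>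
      if (j : ℕ) < N - i then lam else if (j : ℕ) < N then 1 - lam else s
    let b : Fin (N + 1) → ℝ := fun j =>
      if (j : ℕ) < N - i then 1 else if (j : ℕ) < N then 0 else 1
    have h1 : testOp (verifOp ψ lam) (((1 : ℝ) : ℂ) • ketBra ψ + (s : ℂ) • (1 - ketBra ψ)) N i
        = tensorOp fun j => (b j : ℂ) • ketBra ψ + (a j : ℂ) • (1 - ketBra ψ) := by
      unfold testOp
      congr 1
      funext j
      simp only [a, b]
      split_ifs
      · simp [verifOp]
      · exact one_sub_verifOp ψ lam
      · rfl
    rw [h1, hw a b, Fin.prod_univ_castSucc]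
    congr 2
    · rw [← prod_range_ite _ _ hi, ← Fin.prod_univ_eq_prod_range
        (fun j => if j < N - i then (1 + C lam * X : ℝ[X]) else C (1 - lam) * X)]
      refine Finset.prod_congr rfl fun j _ => ?_
      simp only [a, b, Fin.val_castSucc, if_pos j.2]
      split_ifs <;> simp
    · have : ¬ (N < N - i) := by omega
      simp [a, b, this]
  refine ⟨w, hw0, ?_, ?_, ?_⟩
  · rw [acceptProb, acceptPoly, Finset.sum_mul, map_sum]
    refine Finset.sum_congr rfl fun i hi => ?_
    have hi' : i ≤ N := by rw [Finset.mem_range] at hi; omega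
    have h := key i hi' 1
    have e : ((1 : ℝ) : ℂ) • ketBra ψ + ((1 : ℝ) : ℂ) • (1 - ketBra ψ) = 1 := by simp
    rw [e] at h
    rw [h, mul_assoc (C _), ← smul_eq_mul, ← map_smul, smul_eq_C_mul, C_1, one_mul]
  · rw [acceptFid, acceptPoly, map_sum]
    refine Finset.sum_congr rfl fun i hi => ?_
    have hi' : i ≤ N := by rw [Finset.mem_range] at hi; omega
    have h := key i hi' 0
    have e : ((1 : ℝ) : ℂ) • ketBra ψ + ((0 : ℝ) : ℂ) • (1 - ketBra ψ) = ketBra ψ := by simp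
    rw [e] at h
    rw [h, ← smul_eq_mul, ← map_smul, smul_eq_C_mul, C_0, zero_mul, add_zero, mul_one]
  · have h := hw (fun _ => 1) (fun _ => 1)
    have e : ((1 : ℝ) : ℂ) • ketBra ψ + ((1 : ℝ) : ℂ) • (1 - ketBra ψ) = 1 := by simp
    simp only [e, tensorOp_one, one_mul, hρ.2, C_1, Finset.prod_const] at h
    simpa using h.symm

/-- Let g = p − f. The certificate gives (N+1−z) g − z f ≤ (εN−z) δ ≤ (εN−z) p, that is (N+1) g ≤ εN
p. It is checked coefficientwise, the constant 1 being (1 + X)^(N+1) evaluated at w. -/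
lemma one_sub_le_condFid {N k : ℕ} (hk : k ≤ N) {lam : ℝ} (hlam0 : 0 ≤ lam) (hlam1 : lam ≤ 1)
    (hψ : star ψ ⬝ᵥ ψ = 1) {ρ : Matrix (Fin (N + 1) → ι) (Fin (N + 1) → ι) ℂ}
    (hρ : IsDensity ρ) (hinv : IsPermInvariant ρ) {z ε δ : ℝ} (hδ : 0 < δ) (hz0 : 0 ≤ z)
    (hε : 0 ≤ ε) (hzE : z ≤ ε * N)
    (hz : ∀ m : ℕ, (m + 1) * binomCDF m k (1 - lam) - z * binomCDF (m + 1) k (1 - lam)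
      ≤ (ε * N - z) * δ)
    (hp : δ ≤ acceptProb ψ lam k N ρ) : 1 - ε ≤ condFid ψ lam k N ρ := by
  obtain ⟨w, hw0, hwp, hwf, hw1⟩ := exists_accept_eq_umbralEval hk lam hψ hρ hinv
  have hN : (0 : ℝ) < N + 1 := by positivity
  have hr : 0 ≤ (ε * N - z) * δ := mul_nonneg (by linarith) hδ.le
  have hneg : umbralEval (N + 1) w ((N + 1 - z) • (acceptPoly lam k N * X)
      - z • acceptPoly lam k N - ((ε * N - z) * δ) • (1 + X) ^ (N + 1)) ≤ 0 := by
    refine umbralEval_nonpos hw0 fun j _ => ?_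
    simp only [coeff_sub, coeff_smul, smul_eq_mul, coeff_one_add_X_pow, coeff_acceptPoly hk]
    cases j with
    | zero =>
      have h0 : binomCDF 0 k (1 - lam) = 1 := binomCDF_zero_left _ _
      simp [h0]; linarith
    | succ j =>
      rw [coeff_mul_X, coeff_acceptPoly hk]
      have h1 : ((N : ℝ) + 1) * N.choose j = (N + 1).choose (j + 1) * (j + 1) := by
        exact_mod_cast Nat.add_one_mul_choose_eq N j
      have h2 : ((N : ℝ) + 1) * N.choose (j + 1) = (N + 1).choose (j + 1) * (N - j) := by
        have h3 : (((N + 1).choose (j + 1) : ℕ) : ℝ) = N.choose j + N.choose (j + 1) := by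
          rw [Nat.choose_succ_succ]; push_cast; rfl
        rw [h3] at h1 ⊢
        linear_combination -h1
      have h4 : binomCDF (j + 1) k (1 - lam) ≤ binomCDF j k (1 - lam) := by
        rw [binomCDF_succ_left]
        have := binomWeight_nonneg (p := 1 - lam) (by linarith) (by linarith) j k
        nlinarith
      -- This is the excess of (N+1) times `hz j` over the actual coefficient, up to a binomial
      -- factor.
      have h5 : 0 ≤ z * ((j + 1) * (binomCDF j k (1 - lam) - binomCDF (j + 1) k (1 - lam))) :=
        mul_nonneg hz0 (mul_nonneg (by positivity) (by linarith))
      have h6 := mul_le_mul_of_nonneg_left (hz j) hN.le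
      have h7 : (N + 1 - z) * ((j + 1) * binomCDF j k (1 - lam))
          - z * ((N - j) * binomCDF (j + 1) k (1 - lam)) - (N + 1) * ((ε * N - z) * δ) ≤ 0 := by
        linarith
      have h8 : (0 : ℝ) ≤ (N + 1).choose (j + 1) := by positivity
      have h9 := mul_nonpos_of_nonneg_of_nonpos h8 h7
      refine le_of_mul_le_mul_left ?_ hN
      rw [mul_zero]
      refine le_trans (le_of_eq ?_) h9
      linear_combination (N + 1 - z) * binomCDF j k (1 - lam) * h1
        - z * binomCDF (j + 1) k (1 - lam) * h2
  rw [map_sub, map_sub, map_smul, map_smul, map_smul, hw1, ← hwf] at hneg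
  rw [mul_add, mul_one, map_add, ← hwf] at hwp
  simp only [smul_eq_mul, mul_one] at hneg
  have hp0 : 0 < acceptProb ψ lam k N ρ := hδ.trans_le hp
  rw [condFid, le_div_iff₀ hp0]
  have h10 := mul_le_mul_of_nonneg_left hp (show 0 ≤ ε * N - z by linarith)
  have h11 := mul_nonneg hε hp0.le
  obtain ⟨g, hg⟩ : ∃ g, g = umbralEval (N + 1) w (acceptPoly lam k N * X) := ⟨_, rfl⟩
  rw [← hg] at hneg hwp
  have h12 : (N + 1) * g ≤ (N + 1) * (ε * acceptProb ψ lam k N ρ) := by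
    have hgp : g = acceptProb ψ lam k N ρ - acceptFid ψ lam k N ρ := by linarith
    nlinarith
  have h13 := le_of_mul_le_mul_left h12 hN
  linarith

end Functional

section Witness

variable {ι : Type*} [Fintype ι] {ψ : ι → ℂ}

lemma isDensity_tensorOp_ketBra (hψ : star ψ ⬝ᵥ ψ = 1) (m : ℕ) :
    IsDensity (tensorOp fun _ : Fin m => ketBra ψ) := by
  constructor
  · have h : tensorOp (fun _ : Fin m => ketBra ψ)
        = (tensorOp fun _ : Fin m => ketBra ψ).conjTranspose
          * tensorOp fun _ : Fin m => ketBra ψ := by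
      rw [tensorOp_conjTranspose, tensorOp_mul]
      simp [ketBra_conjTranspose, ketBra_mul_self hψ]
    rw [h]
    exact Matrix.posSemidef_conjTranspose_mul_self _
  · simp [trace_tensorOp, trace_ketBra hψ]

variable [DecidableEq ι]

lemma acceptProb_tensorOp_ketBra (hψ : star ψ ⬝ᵥ ψ = 1) (lam : ℝ) {k N : ℕ} (hk : k ≤ N) :
    acceptProb ψ lam k N (tensorOp fun _ => ketBra ψ) = 1 := by
  have h1 : verifOp ψ lam * ketBra ψ = ketBra ψ := by
    simp [verifOp, add_mul, sub_mul, ketBra_mul_self hψ]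
  rw [acceptProb, Finset.sum_eq_single 0]
  · rw [testOp, tensorOp_mul, trace_tensorOp, Finset.prod_eq_one]
    · simp
    · intro j _
      split_ifs with h2 h3
      · rw [h1, trace_ketBra hψ]
      · omega
      · rw [one_mul, trace_ketBra hψ]
  · intro i hi hi0
    rw [Finset.mem_range] at hi
    -- For i > 0 slot N − i carries 1 − Ω, which annihilates the target.
    rw [testOp, tensorOp_mul, trace_tensorOp,
      Finset.prod_eq_zero (Finset.mem_univ (⟨N - i, by omega⟩ : Fin (N + 1)))]
    · simp
    · rw [if_neg (by simp), if_pos (show N - i < N by omega), sub_mul, one_mul, h1, sub_self,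
        Matrix.trace_zero]
  · intro h; simp at h

lemma guaranteedInfidelity_le {N k : ℕ} (hk : k ≤ N) {lam : ℝ} (hlam0 : 0 ≤ lam)
    (hlam1 : lam ≤ 1) (hψ : star ψ ⬝ᵥ ψ = 1) {z ε δ : ℝ} (hδ : 0 < δ) (hδ1 : δ ≤ 1)
    (hz0 : 0 ≤ z) (hε : 0 ≤ ε) (hzE : z ≤ ε * N)
    (hz : ∀ m : ℕ, (m + 1) * binomCDF m k (1 - lam) - z * binomCDF (m + 1) k (1 - lam)
      ≤ (ε * N - z) * δ) :
    guaranteedInfidelity ψ lam k N δ ≤ ε := by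
  rw [guaranteedInfidelity, sub_le_comm]
  -- Without an admissible state the infimum would take the default value 0; N + 1 copies of ψ
  -- exclude this.
  refine le_csInf ⟨_, _, isDensity_tensorOp_ketBra hψ _, isPermInvariant_tensorOp_const _ _, ?_,
    rfl⟩ ?_
  · rw [acceptProb_tensorOp_ketBra hψ lam hk]; exact hδ1
  · rintro F ⟨ρ, hρ, hinv, hp, rfl⟩
    exact one_sub_le_condFid hk hlam0 hlam1 hψ hρ hinv hδ hz0 hε hzE hz hp

end Witness

lemma norm_czDiag {d n : ℕ} [NeZero d] (e : Sym2 (Fin n)) (x : Fin n → ZMod d) :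
    ‖czDiag e x‖ = 1 := by
  rw [czDiag]
  exact AddChar.norm_apply _ _

lemma QuditGraph.star_state_dotProduct_state {d n : ℕ} [NeZero d] (G : QuditGraph d n) :
    star G.state ⬝ᵥ G.state = 1 := by
  have hd : (0 : ℝ) < d := by exact_mod_cast NeZero.pos d
  have h : ∀ x, star G.state x * G.state x = (((d : ℝ) ^ n)⁻¹ : ℝ) := by
    intro x
    have e : ‖G.state x‖ ^ 2 = ((d : ℝ) ^ n)⁻¹ := by
      simp [QuditGraph.state, Matrix.mulVec_diagonal, plusState, norm_prod, norm_czDiag]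
      rw [← pow_mul, mul_comm, pow_mul, sq_abs, Real.sq_sqrt hd.le]
    rw [Pi.star_apply, ← e, Complex.star_def, mul_comm, Complex.mul_conj, Complex.normSq_eq_norm_sq]
  rw [dotProduct, Finset.sum_congr rfl fun x _ => h x]
  simp

end RobustMBQC

end

/-! ### Conclusion -/

namespace RobustMBQC

lemma log_inv_lower_bound {δ : ℝ} (hδ0 : 0 < δ) (hδ : δ ≤ 1 / 2) : 69 / 100 ≤ Real.log δ⁻¹ := by
  have h1 : Real.log 2 ≤ Real.log δ⁻¹ := by
    apply Real.log_le_log (by norm_num)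
    rw [le_inv_comm₀ (by norm_num) hδ0]
    linarith
  linarith [Real.log_two_gt_d9]

/-- Soundness and robustness in terms of `c = lam √(2ν)` and the relative gap `(1 - r) / (c + 1)`. -/
lemma sound_and_robust {ι : Type*} [Fintype ι] [DecidableEq ι] {ψ : ι → ℂ} (hψ : star ψ ⬝ᵥ ψ = 1)
    {lam r ε δ c : ℝ} (hlam0 : 0 < lam) (hlam1 : lam < 1) (hr0 : 0 ≤ r) (hr1 : r < 1)
    (hε0 : 0 < ε) (hε1 : ε < 1) (hδ0 : 0 < δ) (hδ : δ ≤ 1 / 2) (hc0 : 0 < c)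
    (hc : c ^ 2 = 2 * lam ^ 2 * (1 - lam)) {N k : ℕ}
    (hk : k = ⌊(c + r) / (c + 1) * ((1 - lam) * ε * N)⌋₊)
    (hN : ((c + 1) / (lam * (1 - lam) * (1 - r))) ^ 2
      * ((Real.log δ⁻¹ + 4 * lam * (1 - lam) ^ 2) / ε) ≤ N) :
    k + 1 ≤ N ∧ guaranteedInfidelity ψ lam k N δ ≤ ε ∧
      1 - δ ≤ binomCDF N k ((1 - lam) * r * ε) := by
  have hL := log_inv_lower_bound hδ0 hδ
  obtain ⟨L, hLdef⟩ : ∃ L, L = Real.log δ⁻¹ := ⟨_, rfl⟩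
  have hδL : δ = Real.exp (-L) := by rw [hLdef, Real.log_inv, neg_neg, Real.exp_log hδ0]
  rw [← hLdef] at hL hN
  obtain ⟨ν, hν⟩ : ∃ ν, ν = 1 - lam := ⟨_, rfl⟩
  rw [← hν] at hk hN hc ⊢
  have hν0 : 0 < ν := by linarith
  have hν1 : ν < 1 := by linarith
  obtain ⟨t, ht⟩ : ∃ t, t = (1 - r) / (c + 1) := ⟨_, rfl⟩
  have hc1 : 0 < c + 1 := by linarith
  have ht0 : 0 < t := by rw [ht]; exact div_pos (by linarith) hc1
  have hcr : (c + r) / (c + 1) = 1 - t := by rw [ht]; field_simp; ring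
  have hcr0 : 0 < 1 - t := by rw [← hcr]; positivity
  have hrt : 1 - t - r = c * t := by rw [ht]; field_simp; ring
  rw [hcr] at hk
  have hL0 : 0 < L + 4 * lam * ν ^ 2 := by positivity
  -- the bound on the number of tests
  have hNt : L + 4 * lam * ν ^ 2 ≤ (lam * ν * t) ^ 2 * (ε * N) := by
    have e1 : (c + 1) / (lam * ν * (1 - r)) = 1 / (lam * ν * t) := by
      have : 1 - r ≠ 0 := by linarith
      rw [ht]; field_simp
    rw [e1, one_div, inv_pow, ← div_eq_inv_mul, div_div, div_le_iff₀ (by positivity)] at hN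
    linarith
  have hE : 0 < ε * N := by
    by_contra h
    nlinarith [sq_nonneg (lam * ν * t)]
  have hN0 : (0 : ℝ) < N := by
    by_contra h
    nlinarith
  have hx0 : 0 < (1 - t) * (ν * ε * N) := by positivity
  have hkx : (k : ℝ) ≤ (1 - t) * (ν * ε * N) := by
    rw [hk]; exact Nat.floor_le hx0.le
  have hxk : (1 - t) * (ν * ε * N) ≤ k + 1 := by
    rw [hk]; exact (Nat.lt_floor_add_one _).le
  have hkE : (k : ℝ) ≤ (1 - t) * ν * (ε * N) := by linarith
  have hkN : k < N := by
    have h1 : (1 - t) * ν * (ε * N) < N := by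
      have h2 : (1 - t) * ν * ε < 1 := by
        have : (1 - t) * ν < 1 := by nlinarith
        nlinarith [mul_pos hcr0 hν0]
      nlinarith
    exact_mod_cast hkE.trans_lt h1
  refine ⟨hkN, ?_, ?_⟩
  -- The gap G is at least tE, so the bound on N yields the quadratic hypothesis on G.
  · have hG : t * (ε * N) ≤ ε * N - k / ν := by
      have : (k : ℝ) / ν ≤ (1 - t) * (ε * N) := by
        rw [div_le_iff₀ hν0]; linarith
      linarith
    have hG0 : 0 < ε * N - k / ν := lt_of_lt_of_le (by positivity) hG
    obtain ⟨z, hz0, hzE, hz⟩ := exists_soundness_inequality (E := ε * N) hν0 hlam0 (by linarith) hL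
      (k := k) hG0 (by ring) (by
        calc (L + 4 * lam * ν ^ 2) * (ε * N) ≤ (lam * ν * t) ^ 2 * (ε * N) * (ε * N) := by gcongr
          _ = (lam * ν * (t * (ε * N))) ^ 2 := by ring
          _ ≤ _ := by gcongr)
    rw [← hδL, hν] at hz
    exact guaranteedInfidelity_le hkN.le hlam0.le hlam1.le hψ hδ0 (by linarith) hz0 hε0.le hzE hz
  · have hp1 : ν * r * ε ≤ 1 :=
      mul_le_one₀ (mul_le_one₀ hν1.le hr0 hr1.le) hε0.le hε1.le
    have hdev : (1 - t) * (ν * ε * N) - N * (ν * r * ε) = c * t * (ν * (ε * N)) := by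
      rw [← hrt]; ring
    refine le_trans ?_ (one_sub_exp_le_binomCDF (by positivity) hp1 (x := (1 - t) * (ν * ε * N))
      (sub_nonneg.1 (by rw [hdev]; positivity)) hx0 hxk)
    rw [hδL]
    refine sub_le_sub_left (Real.exp_le_exp.2 (neg_le_neg ?_)) 1
    rw [hdev, le_div_iff₀ (by positivity)]
    have h1 : L ≤ (lam * ν * t) ^ 2 * (ε * N) := by
      have : 0 ≤ 4 * lam * ν ^ 2 := by positivity
      linarith
    calc L * (2 * ((1 - t) * (ν * ε * N))) ≤ L * (2 * (1 * (ν * ε * N))) := by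
          gcongr; linarith
      _ = 2 * ν * (ε * N) * L := by ring
      _ ≤ 2 * ν * (ε * N) * ((lam * ν * t) ^ 2 * (ε * N)) := by gcongr
      _ = (2 * lam ^ 2 * ν) * (t * (ν * (ε * N))) ^ 2 := by ring
      -- The value c² = 2λ²ν is what makes the robustness exponent reach L.
      _ = _ := by rw [← hc]; ring

/-- As L > 1/2 and ε < 1, both v ≤ 2vL and the rounding error 1 ≤ 2L/ε are absorbed. -/
lemma ceil_le_const_mul {K v ε L : ℝ} (hK : 0 ≤ K) (hv : 0 ≤ v) (hε0 : 0 < ε) (hε1 : ε < 1)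
    (hL : 69 / 100 ≤ L) :
    (⌈K * ((L + v) / ε)⌉₊ : ℝ) ≤ (K * (1 + 2 * v) + 2) * (ε⁻¹ * L) := by
  have hi : 1 ≤ ε⁻¹ := (one_le_inv₀ hε0).2 hε1.le
  have h1 : K * ((L + v) / ε) = K * (L + v) * ε⁻¹ := by ring
  have h2 : K * (L + v) * ε⁻¹ ≤ K * ((1 + 2 * v) * L) * ε⁻¹ := by
    gcongr; nlinarith
  have h3 : 1 ≤ 2 * (ε⁻¹ * L) := by nlinarith
  have h4 := (Nat.ceil_lt_add_one (show 0 ≤ K * ((L + v) / ε) by positivity)).le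
  rw [h1] at h4 ⊢
  linarith

end RobustMBQC

theorem theorem3 (lam r : ℝ) (hlam0 : 0 < lam) (hlam1 : lam < 1) (hr0 : 0 ≤ r) (hr1 : r < 1) :
    (∀ (d n : ℕ) [Fact d.Prime] (G : RobustMBQC.QuditGraph d n) (ε δ : ℝ),
      0 < ε → ε < 1 → 0 < δ → δ ≤ 1 / 2 →
        (∀ k N : ℕ,
          k = ⌊(lam * √(2 * (1 - lam)) + r) / (lam * √(2 * (1 - lam)) + 1)
                * ((1 - lam) * ε * N)⌋₊ →
          ⌈((lam * √(2 * (1 - lam)) + 1) / (lam * (1 - lam) * (1 - r))) ^ 2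
                * ((Real.log δ⁻¹ + 4 * lam * (1 - lam) ^ 2) / ε)⌉₊ ≤ N →
          k + 1 ≤ N ∧
          RobustMBQC.guaranteedInfidelity G.state lam k N δ ≤ ε ∧
          1 - δ ≤ RobustMBQC.binomCDF N k ((1 - lam) * r * ε)) ∧
        RobustMBQC.minTests G.state ε δ lam r ≤
          ⌈((lam * √(2 * (1 - lam)) + 1) / (lam * (1 - lam) * (1 - r))) ^ 2
                * ((Real.log δ⁻¹ + 4 * lam * (1 - lam) ^ 2) / ε)⌉₊) ∧
    (∃ C : ℝ, 0 < C ∧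
      ∀ (d n : ℕ) [Fact d.Prime] (G : RobustMBQC.QuditGraph d n) (ε δ : ℝ),
        0 < ε → ε < 1 → 0 < δ → δ ≤ 1 / 2 →
          (RobustMBQC.minTests G.state ε δ lam r : ℝ) ≤ C * (ε⁻¹ * Real.log δ⁻¹)) := by
  have hν0 : 0 < 1 - lam := by linarith
  have hc0 : 0 < lam * √(2 * (1 - lam)) := by positivity
  have hc : (lam * √(2 * (1 - lam))) ^ 2 = 2 * lam ^ 2 * (1 - lam) := by
    rw [mul_pow, Real.sq_sqrt (by linarith)]; ring
  have main : ∀ (d n : ℕ) [Fact d.Prime] (G : RobustMBQC.QuditGraph d n) (ε δ : ℝ),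
      0 < ε → ε < 1 → 0 < δ → δ ≤ 1 / 2 →
        (∀ k N : ℕ,
          k = ⌊(lam * √(2 * (1 - lam)) + r) / (lam * √(2 * (1 - lam)) + 1)
                * ((1 - lam) * ε * N)⌋₊ →
          ⌈((lam * √(2 * (1 - lam)) + 1) / (lam * (1 - lam) * (1 - r))) ^ 2
                * ((Real.log δ⁻¹ + 4 * lam * (1 - lam) ^ 2) / ε)⌉₊ ≤ N →
          k + 1 ≤ N ∧
          RobustMBQC.guaranteedInfidelity G.state lam k N δ ≤ ε ∧
          1 - δ ≤ RobustMBQC.binomCDF N k ((1 - lam) * r * ε)) ∧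
        RobustMBQC.minTests G.state ε δ lam r ≤
          ⌈((lam * √(2 * (1 - lam)) + 1) / (lam * (1 - lam) * (1 - r))) ^ 2
                * ((Real.log δ⁻¹ + 4 * lam * (1 - lam) ^ 2) / ε)⌉₊ := by
    intro d n _ G ε δ hε0 hε1 hδ0 hδ
    have h := fun (k N : ℕ) hk hN => RobustMBQC.sound_and_robust (N := N) (k := k)
      G.star_state_dotProduct_state hlam0 hlam1 hr0 hr1 hε0 hε1 hδ0 hδ hc0 hc hk (Nat.ceil_le.1 hN)
    exact ⟨h, Nat.sInf_le ⟨_, h _ _ rfl le_rfl⟩⟩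
  refine ⟨main, ((lam * √(2 * (1 - lam)) + 1) / (lam * (1 - lam) * (1 - r))) ^ 2
    * (1 + 2 * (4 * lam * (1 - lam) ^ 2)) + 2, by positivity, ?_⟩
  intro d n _ G ε δ hε0 hε1 hδ0 hδ
  exact (Nat.cast_le.2 (main d n G ε δ hε0 hε1 hδ0 hδ).2).trans
    (RobustMBQC.ceil_le_const_mul (by positivity) (by positivity) hε0 hε1
      (RobustMBQC.log_inv_lower_bound hδ0 hδ))
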